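/- Let $p$ be a prime, $\mathbb{F}_p$ the field with $p$ elements, and fix a real number $\epsilon\in(0,1-1/p]$. A random variable $\xi$ in $\mathbb{F}_p$ is called $\epsilon$-balanced if $\mathbf{P}(\xi=a)\le 1-\epsilon$ for every $a\in\mathbb{F}_p$. Let $\mathbb{Y}$ be the set of integer partitions $\lambda=(\lambda_1\ge\lambda_2\ge\cdots\ge 0)$ with finitely many nonzero parts, and let $S$ be the set of monic irreducible polynomials in $\mathbb{F}_p[t]$. For a monic polynomial $g=t^m+a_{m-1}t^{m-1}+\cdots+a_0$ let $C(g)$ be its companion matrix, the $m\times m$ matrix with ones just above the diagonal, last row $(-a_0,\ldots,-a_{m-1})$, and zeros elsewhere. For every $A\in\mathrm{Mat}_n(\mathbb{F}_p)$ there is a unique family of partitions $\lambda^{(f)}=\lambda^{(f)}(A)\in\mathbb{Y}$, $f\in S$, such that $A$ is conjugate under $\mathrm{GL}_n(\mathbb{F}_p)$ to a block diagonal matrix with the blocks $C\bigl(f^{\lambda^{(f)}_j}\bigr)$, where $f\in S$, $j\ge 1$ and $\lambda^{(f)}_j>0$ (the rational canonical form of $A$). **Theorem.** For each $n$, let $A_n\in\mathrm{Mat}_n(\mathbb{F}_p)$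 be a random matrix whose entries are independent and $\epsilon$-balanced. Let $f_1,\ldots,f_r\in S$ be distinct. Then the joint distribution of $(\lambda^{(f_1)}(A_n),\ldots,\lambda^{(f_r)}(A_n))$ converges pointwise to the product measure $\prod_{i=1}^r\mu_{f_i}$ on $\mathbb{Y}^r$ as $n\to\infty$; that is, for all $\kappa_1,\ldots,\kappa_r\in\mathbb{Y}$, $$\lim_{n\to\infty}\mathbf{P}\bigl(\lambda^{(f_i)}(A_n)=\kappa_i\text{ for all }1\le i\le r\bigr)=\prod_{i=1}^r\mu_{f_i}(\kappa_i).$$ Here, for $f\in S$ and $\lambda\in\mathbb{Y}$ with parts $\lambda_1\ge\lambda_2\ge\cdots$, $$\mu_f(\lambda)=\frac{1}{\#\mathrm{Aut}_f(\lambda)}\prod_{j=1}^{\infty}\bigl(1-p^{-j\deg f}\bigr),$$ where $\mathrm{Aut}_f(\lambda)$ is the group of automorphisms of the $\mathbb{F}_p[t]$-module $\bigoplus_{j\ge1}\mathbb{F}_p[t]/(f^{\lambda_j})$. -/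

import Mathlib

open Polynomial Filter Topology MeasureTheory ProbabilityTheory
open scoped DirectSum

noncomputable section

/-- Integer partitions `l₀ ≥ l₁ ≥ l₂ ≥ ⋯ ≥ 0` of arbitrary size: weakly decreasing sequences of
natural numbers with finitely many nonzero terms (indexed from `0`). -/
@[ext]
structure IntPartition where
  /-- The sequence of parts, padded with zeros. -/
  parts : ℕ →₀ ℕ
  antitone_parts : Antitone parts

/-- The zero partition. -/
instance : Zero IntPartition := ⟨⟨0, antitone_const⟩⟩

/-- The set of monic irreducible polynomials over a field `K`
(they are automatically nonconstant, as units are not irreducible). -/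
abbrev MonicIrred (K : Type*) [Field K] : Type _ := {f : K[X] // f.Monic ∧ Irreducible f}

/-- The companion matrix of a monic polynomial `g = t ^ r + a_{r-1} t ^ (r-1) + ⋯ + a₀`: ones just
above the diagonal, last row `(-a₀, …, -a_{r-1})`, zeros elsewhere. For `g = 1` it is the empty
matrix. -/
def companionMatrix {K : Type*} [Field K] (g : K[X]) :
    Matrix (Fin g.natDegree) (Fin g.natDegree) K :=
  Matrix.of fun i j =>
    if (i : ℕ) + 1 = g.natDegree then -g.coeff j
    else if (j : ℕ) = (i : ℕ) + 1 then 1 else 0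

open Classical in
/-- `IsRationalCanonicalData A Λ` says that `A` is conjugate under `GL_n(K)` to a block diagonal
matrix with the blocks `C(f ^ (Λ f)_j)`, for `f` monic irreducible and `j = 0, 1, 2, …`.
A zero part contributes an empty block, and the bijection `e`, which lists the rows of all the
blocks, forces all but finitely many of the blocks to be empty and the block sizes to add up
to `n`. -/
def IsRationalCanonicalData {K : Type*} [Field K] {n : ℕ} (A : Matrix (Fin n) (Fin n) K)
    (Λ : MonicIrred K → IntPartition) : Prop :=
  ∃ (P : GL (Fin n) K)
    (e : (Σ b : MonicIrred K × ℕ, Fin (b.1.1 ^ (Λ b.1).parts b.2).natDegree) ≃ Fin n),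
    (P⁻¹).val * A * P.val =
      Matrix.reindex e e
        (Matrix.blockDiagonal' fun b : MonicIrred K × ℕ =>
          companionMatrix (b.1.1 ^ (Λ b.1).parts b.2))

open Classical in
/-- The partition `λ^(f)(A)` attached to a square matrix `A` and a monic irreducible polynomial `f`
by the rational canonical form of `A`. (Every square matrix over a field has exactly one family of
rational canonical data, so that the second branch never occurs.) -/
def rcfPartition {K : Type*} [Field K] {n : ℕ} (A : Matrix (Fin n) (Fin n) K)
    (f : MonicIrred K) : IntPartition :=
  if h : ∃ Λ : MonicIrred K → IntPartition, IsRationalCanonicalData A Λ then h.choose f else 0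

/-- The `K[t]`-module `⨁_j K[t] / (f ^ l_j)`. -/
abbrev partitionModule {K : Type*} [Field K] (f : K[X]) (l : IntPartition) : Type _ :=
  ⨁ j : ℕ, (K[X] ⧸ Ideal.span {f ^ l.parts j})

/-- The mass that the Cohen–Lenstra measure `μ_f` gives to the partition `l`:
`∏_{j ≥ 1} (1 - p ^ (-j deg f)) / #Aut_{F_p[t]} (⨁_j F_p[t] / (f ^ l_j))`. -/
def cohenLenstraMass (p : ℕ) [Fact p.Prime] (f : MonicIrred (ZMod p)) (l : IntPartition) : ℝ :=
  1 / (Nat.card (partitionModule f.1 l ≃ₗ[(ZMod p)[X]] partitionModule f.1 l) : ℝ) *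
    ∏' j : ℕ, (1 - ((p : ℝ) ^ ((j + 1) * f.1.natDegree))⁻¹)

/-- A random variable `ξ : Ω → F_p` is `ε`-balanced if `P(ξ = a) ≤ 1 - ε` for all `a ∈ F_p`. -/
def IsBalanced {p : ℕ} {Ω : Type*} [MeasurableSpace Ω] (P : Measure Ω) (ε : ℝ)
    (ξ : Ω → ZMod p) : Prop :=
  ∀ a : ZMod p, P.real {ω | ξ ω = a} ≤ 1 - ε

end

section Characters

variable {p : ℕ} [Fact p.Prime]

/-- A probability vector on `ZMod p` whose atoms have mass at most `1 - ε`. -/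
structure IsBalancedWeight (ε : ℝ) (w : ZMod p → ℝ) : Prop where
  nonneg : ∀ x, 0 ≤ w x
  sum_eq_one : ∑ x, w x = 1
  le : ∀ x, w x ≤ 1 - ε

theorem ZMod.exists_pos_le_one_sub_re_stdAddChar :
    ∃ c : ℝ, 0 < c ∧ ∀ b : ZMod p, b ≠ 0 → c ≤ 1 - (ZMod.stdAddChar b : ℂ).re := by
  classical
  obtain ⟨b, hb, hmin⟩ := Finset.exists_min_image (Finset.univ.filter fun b : ZMod p => b ≠ 0)
    (fun b => 1 - (ZMod.stdAddChar b : ℂ).re) ⟨1, by simp⟩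
  refine ⟨_, ?_, fun b' hb' => hmin b' (by simp [hb'])⟩
  have hn : ‖(ZMod.stdAddChar b : ℂ)‖ = 1 := AddChar.norm_apply _ _
  have hle : (ZMod.stdAddChar b : ℂ).re ≤ 1 := hn ▸ Complex.re_le_norm _
  rcases hle.lt_or_eq with h | h
  · linarith
  · exfalso
    have hsq : (ZMod.stdAddChar b : ℂ).re ^ 2 + (ZMod.stdAddChar b : ℂ).im ^ 2 = 1 := by
      rw [← one_pow 2, ← hn, Complex.sq_norm, Complex.normSq_apply]; ring
    have him : (ZMod.stdAddChar b : ℂ).im = 0 := by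
      rw [h] at hsq
      exact pow_eq_zero_iff (two_ne_zero) |>.1 (by linarith)
    have : (ZMod.stdAddChar b : ℂ) = ZMod.stdAddChar (0 : ZMod p) := by
      rw [AddChar.map_zero_eq_one]
      exact Complex.ext h him
    exact (Finset.mem_filter.1 hb).2 (ZMod.injective_stdAddChar this)

/-- The characteristic function of a probability vector on `ZMod p`. -/
noncomputable def weightChar (w : ZMod p → ℝ) (a : ZMod p) : ℂ :=
  ∑ x, (w x : ℂ) * ZMod.stdAddChar (a * x)

theorem sq_norm_weightChar (w : ZMod p → ℝ) (a : ZMod p) :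
    ‖weightChar w a‖ ^ 2
      = ∑ x, ∑ y, w x * w y * (ZMod.stdAddChar (a * (x - y)) : ℂ).re := by
  have h : ((‖weightChar w a‖ ^ 2 : ℝ) : ℂ)
      = ∑ x, ∑ y, ((w x * w y : ℝ) : ℂ) * ZMod.stdAddChar (a * (x - y)) := by
    push_cast
    rw [← Complex.mul_conj', weightChar, map_sum, Finset.sum_mul_sum]
    refine Finset.sum_congr rfl fun x _ => Finset.sum_congr rfl fun y _ => ?_
    rw [(starRingEnd ℂ).map_mul, Complex.conj_ofReal, ← AddChar.map_neg_eq_conj, mul_sub,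
      sub_eq_add_neg, AddChar.map_add_eq_mul]
    ring
  have := congrArg Complex.re h
  rw [Complex.ofReal_re] at this
  rw [this, Complex.re_sum]
  refine Finset.sum_congr rfl fun x _ => ?_
  rw [Complex.re_sum]
  exact Finset.sum_congr rfl fun y _ => Complex.re_ofReal_mul _ _

theorem norm_weightChar_le_one {ε : ℝ} {w : ZMod p → ℝ} (hw : IsBalancedWeight ε w)
    (a : ZMod p) : ‖weightChar w a‖ ≤ 1 := by
  rw [← hw.sum_eq_one]
  refine (norm_sum_le _ _).trans (Finset.sum_le_sum fun x _ => ?_)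
  rw [norm_mul, AddChar.norm_apply, mul_one, Complex.norm_real, Real.norm_eq_abs,
    abs_of_nonneg (hw.nonneg x)]

theorem exists_norm_weightChar_le {ε : ℝ} (hε : 0 < ε) :
    ∃ ρ : ℝ, 0 ≤ ρ ∧ ρ < 1 ∧ ∀ w : ZMod p → ℝ, IsBalancedWeight ε w →
      ∀ a, a ≠ 0 → ‖weightChar w a‖ ≤ ρ := by
  obtain ⟨c, hc, hcb⟩ := ZMod.exists_pos_le_one_sub_re_stdAddChar (p := p)
  refine ⟨√(1 - c * ε), Real.sqrt_nonneg _, ?_, fun w hw a ha => ?_⟩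
  · rw [Real.sqrt_lt' one_pos]
    nlinarith [mul_pos hc hε]
  · refine (le_abs_self _).trans (Real.abs_le_sqrt ?_)
    rw [sq_norm_weightChar]
    have h1 : ∑ x, ∑ y, w x * w y = 1 := by
      rw [← Finset.sum_mul_sum, hw.sum_eq_one, one_mul]
    have h2 : ∑ x, w x * w x ≤ 1 - ε := by
      calc ∑ x, w x * w x ≤ ∑ x, w x * (1 - ε) :=
            Finset.sum_le_sum fun x _ => mul_le_mul_of_nonneg_left (hw.le x) (hw.nonneg x)
        _ = 1 - ε := by rw [← Finset.sum_mul, hw.sum_eq_one, one_mul]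
    have h3 : ∀ x y, w x * w y * (ZMod.stdAddChar (a * (x - y)) : ℂ).re
        ≤ (1 - c) * (w x * w y) + if x = y then c * (w x * w y) else 0 := by
      intro x y
      have hxy := mul_nonneg (hw.nonneg x) (hw.nonneg y)
      split_ifs with h
      · subst h
        simp
        linarith
      · have := hcb (a * (x - y)) (mul_ne_zero ha (sub_ne_zero.2 h))
        nlinarith
    calc _ ≤ ∑ x, ∑ y, ((1 - c) * (w x * w y) + if x = y then c * (w x * w y) else 0) :=
          Finset.sum_le_sum fun x _ => Finset.sum_le_sum fun y _ => h3 x y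
      _ = (1 - c) + c * ∑ x, w x * w x := by
          have h4 : ∑ x, ∑ y, (1 - c) * (w x * w y) = 1 - c := by
            calc _ = (1 - c) * ∑ x, ∑ y, w x * w y := by simp only [Finset.mul_sum]
              _ = 1 - c := by rw [h1, mul_one]
          simp only [Finset.sum_add_distrib, h4, Finset.mul_sum, Finset.sum_ite_eq,
            Finset.mem_univ, if_true]
      _ ≤ 1 - c * ε := by nlinarith

end Characters

section RowMass

open Classical in
/-- The mass that a product of weights gives to a predicate. -/
noncomputable def rowMass {p : ℕ} [Fact p.Prime] {ι : Type*} [Fintype ι] [DecidableEq ι]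
    (w : ι → ZMod p → ℝ) (Q : (ι → ZMod p) → Prop) : ℝ :=
  ∑ v : ι → ZMod p, if Q v then ∏ i, w i (v i) else 0

variable {p : ℕ} [Fact p.Prime] {ι : Type*} [Fintype ι] {ε : ℝ} {w : ι → ZMod p → ℝ}

theorem prod_weight_nonneg (hw : ∀ i, IsBalancedWeight ε (w i)) (v : ι → ZMod p) :
    0 ≤ ∏ i, w i (v i) :=
  Finset.prod_nonneg fun i _ => (hw i).nonneg _

theorem stdAddChar_sum (x : ι → ZMod p) :
    (ZMod.stdAddChar (∑ i, x i) : ℂ) = ∏ i, (ZMod.stdAddChar (x i) : ℂ) := by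
  have := map_prod (ZMod.stdAddChar (N := p)).toMonoidHom (fun i => Multiplicative.ofAdd (x i))
    Finset.univ
  rw [← ofAdd_sum] at this
  exact this

open Classical in
theorem sum_stdAddChar_mem {H : Type*} [AddCommGroup H] [Module (ZMod p) H]
    (D : Submodule (ZMod p) (Module.Dual (ZMod p) H)) [Fintype D] (x : H) :
    ∑ l : D, (ZMod.stdAddChar ((l : Module.Dual (ZMod p) H) x) : ℂ)
      = if x ∈ D.dualCoannihilator then (Nat.card D : ℂ) else 0 := by
  let χ : AddChar D ℂ :=
    { toFun := fun l => ZMod.stdAddChar ((l : Module.Dual (ZMod p) H) x)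
      map_zero_eq_one' := by simp
      map_add_eq_mul' := fun a b => by simp [AddChar.map_add_eq_mul] }
  have h := AddChar.sum_eq_ite χ
  have h0 : χ = 0 ↔ x ∈ D.dualCoannihilator := by
    rw [Submodule.mem_dualCoannihilator]
    constructor
    · intro h l hl
      have h1 : χ ⟨l, hl⟩ = 1 := by rw [h]; rfl
      exact ZMod.injective_stdAddChar (h1.trans (AddChar.map_zero_eq_one _).symm)
    · intro h
      ext l
      change (ZMod.stdAddChar ((l : Module.Dual (ZMod p) H) x) : ℂ) = 1
      rw [h _ l.2, AddChar.map_zero_eq_one]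
  rw [show ∑ l : D, (ZMod.stdAddChar ((l : Module.Dual (ZMod p) H) x) : ℂ) = ∑ l, χ l from rfl, h]
  simp only [h0, Nat.card_eq_fintype_card]

variable [DecidableEq ι]

theorem sum_prod_weight (hw : ∀ i, IsBalancedWeight ε (w i)) :
    ∑ v : ι → ZMod p, ∏ i, w i (v i) = 1 := by
  classical
  rw [← Fintype.piFinset_univ, ← Finset.prod_univ_sum]
  exact Finset.prod_eq_one fun i _ => (hw i).sum_eq_one

theorem rowMass_nonneg (hw : ∀ i, IsBalancedWeight ε (w i)) (Q : (ι → ZMod p) → Prop) :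
    0 ≤ rowMass w Q :=
  Finset.sum_nonneg fun v _ => by
    split_ifs
    exacts [prod_weight_nonneg hw v, le_rfl]

theorem rowMass_true (hw : ∀ i, IsBalancedWeight ε (w i)) {Q : (ι → ZMod p) → Prop}
    (hQ : ∀ v, Q v) : rowMass w Q = 1 := by
  simp [rowMass, hQ, sum_prod_weight hw]

variable {H : Type*} [AddCommGroup H] [Module (ZMod p) H]

/-- A coset of a proper subspace has mass at most `1 - ε` for a sum with a summand direction
outside the subspace. -/
theorem rowMass_mem_le (hw : ∀ i, IsBalancedWeight ε (w i)) (F : ι → H)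
    (U : Submodule (ZMod p) H) (g : H) {i₀ : ι} (hi₀ : F i₀ ∉ U) :
    rowMass w (fun v => ∑ i, v i • F i - g ∈ U) ≤ 1 - ε := by
  classical
  have key : ∀ v : {j // j ≠ i₀} → ZMod p,
      ∑ x : ZMod p, (if x • F i₀ + ∑ j : {j // j ≠ i₀}, v j • F j - g ∈ U then w i₀ x else 0)
        ≤ 1 - ε := by
    intro v
    by_cases h : ∃ x : ZMod p, x • F i₀ + ∑ j : {j // j ≠ i₀}, v j • F j - g ∈ U
    · obtain ⟨x, hx⟩ := h
      rw [Finset.sum_eq_single x]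
      · rw [if_pos hx]; exact (hw i₀).le x
      · intro y _ hyx
        rw [if_neg]
        intro hy
        have := U.sub_mem hy hx
        rw [show y • F i₀ + ∑ j : {j // j ≠ i₀}, v j • F j - g
          - (x • F i₀ + ∑ j : {j // j ≠ i₀}, v j • F j - g) = (y - x) • F i₀ by
            rw [sub_smul]; abel] at this
        exact hi₀ ((U.smul_mem_iff (sub_ne_zero.2 hyx)).1 this)
      · simp
    · push Not at h
      rw [Finset.sum_eq_zero fun x _ => if_neg (h x)]
      exact ((hw i₀).nonneg 0).trans ((hw i₀).le 0)
  rw [rowMass, ← (Equiv.funSplitAt i₀ (ZMod p)).symm.sum_comp, Fintype.sum_prod_type_right]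
  have hval : ∀ (x : ZMod p) (v : {j // j ≠ i₀} → ZMod p),
      (if ∑ i, ((Equiv.funSplitAt i₀ (ZMod p)).symm (x, v)) i • F i - g ∈ U then
        ∏ i, w i (((Equiv.funSplitAt i₀ (ZMod p)).symm (x, v)) i) else 0)
      = (∏ j : {j // j ≠ i₀}, w j (v j)) *
        (if x • F i₀ + ∑ j : {j // j ≠ i₀}, v j • F j - g ∈ U then w i₀ x else 0) := by
    intro x v
    have e0 : ((Equiv.funSplitAt i₀ (ZMod p)).symm (x, v)) i₀ = x := by
      simp
    have e1 : ∀ j : {j // j ≠ i₀}, ((Equiv.funSplitAt i₀ (ZMod p)).symm (x, v)) j = v j := by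
      intro j; simp [j.2]
    rw [Fintype.sum_eq_add_sum_subtype_ne _ i₀, Fintype.prod_eq_mul_prod_subtype_ne _ i₀]
    simp only [e0, e1]
    split_ifs <;> simp [mul_comm]
  simp only [hval, ← Finset.mul_sum]
  calc _ ≤ ∑ v : {j // j ≠ i₀} → ZMod p, (∏ j : {j // j ≠ i₀}, w j (v j)) * (1 - ε) :=
        Finset.sum_le_sum fun v _ => mul_le_mul_of_nonneg_left (key v)
          (Finset.prod_nonneg fun j _ => (hw j).nonneg _)
    _ = 1 - ε := by
        rw [← Finset.sum_mul, sum_prod_weight (w := fun j : {j // j ≠ i₀} => w j)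
          (fun j => hw j), one_mul]

theorem sum_weightChar_mem (D : Submodule (ZMod p) (Module.Dual (ZMod p) H)) [Fintype D]
    (F : ι → H) (g : H) :
    ∑ l : D, (ZMod.stdAddChar (-(l : Module.Dual (ZMod p) H) g) : ℂ)
        * ∏ i, weightChar (w i) ((l : Module.Dual (ZMod p) H) (F i))
      = Nat.card D * rowMass w (fun v => ∑ i, v i • F i - g ∈ D.dualCoannihilator) := by
  classical
  have h : ∀ l : D, (ZMod.stdAddChar (-(l : Module.Dual (ZMod p) H) g) : ℂ)
        * ∏ i, weightChar (w i) ((l : Module.Dual (ZMod p) H) (F i))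
      = ∑ v : ι → ZMod p, ((∏ i, w i (v i) : ℝ) : ℂ) *
          ZMod.stdAddChar ((l : Module.Dual (ZMod p) H) (∑ i, v i • F i - g)) := by
    intro l
    simp only [weightChar]
    rw [Finset.prod_univ_sum, Fintype.piFinset_univ, Finset.mul_sum]
    refine Finset.sum_congr rfl fun v _ => ?_
    rw [Finset.prod_mul_distrib, map_sub, map_sum, sub_eq_add_neg, AddChar.map_add_eq_mul,
      stdAddChar_sum]
    simp only [map_smul, smul_eq_mul, mul_comm (v _)]
    push_cast
    ring
  simp only [h]
  rw [Finset.sum_comm]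
  simp only [← Finset.mul_sum, sum_stdAddChar_mem]
  rw [rowMass, Complex.ofReal_sum, Finset.mul_sum]
  refine Finset.sum_congr rfl fun v _ => ?_
  split_ifs
  · ring
  · simp

variable [Finite H]

open Classical in
theorem abs_rowMass_sub_le (hw : ∀ i, IsBalancedWeight ε (w i)) {ρ : ℝ} (hρ0 : 0 ≤ ρ)
    (hρ1 : ρ ≤ 1) (hρ : ∀ i a, a ≠ 0 → ‖weightChar (w i) a‖ ≤ ρ) (F : ι → H)
    (U : Submodule (ZMod p) H) (m : ℕ)
    (hm : ∀ l : Module.Dual (ZMod p) H, l ∉ U.dualAnnihilator →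
      m ≤ (Finset.univ.filter fun i => l (F i) ≠ 0).card) (g : H) :
    |rowMass w (fun v => ∑ i, v i • F i = g)
      - (Nat.card U : ℝ)⁻¹ * rowMass w (fun v => ∑ i, v i • F i - g ∈ U)| ≤ ρ ^ m := by
  have : Finite (Module.Dual (ZMod p) H) := Module.finite_of_finite (ZMod p)
  have : Fintype (Module.Dual (ZMod p) H) := Fintype.ofFinite _
  have : Fintype H := Fintype.ofFinite _
  set c : Module.Dual (ZMod p) H → ℂ := fun l =>
    (ZMod.stdAddChar (-l g) : ℂ) * ∏ i, weightChar (w i) (l (F i)) with hc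
  have hall : ∑ l, c l = Nat.card H * rowMass w (fun v => ∑ i, v i • F i = g) := by
    have := sum_weightChar_mem (w := w) (⊤ : Submodule (ZMod p) (Module.Dual (ZMod p) H)) F g
    have e1 : (⊤ : Submodule (ZMod p) (Module.Dual (ZMod p) H)).dualCoannihilator = ⊥ := by simp
    have e2 : Nat.card (⊤ : Submodule (ZMod p) (Module.Dual (ZMod p) H)) = Nat.card H := by
      rw [Nat.card_congr Submodule.topEquiv.toEquiv, Nat.card_eq_fintype_card,
        Nat.card_eq_fintype_card, Module.card_eq_pow_finrank (K := ZMod p),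
        Module.card_eq_pow_finrank (K := ZMod p) (V := H), Subspace.dual_finrank_eq]
    rw [e1, e2] at this
    simp only [Submodule.mem_bot, sub_eq_zero] at this
    rw [← this]
    exact (Submodule.topEquiv (R := ZMod p) (M := Module.Dual (ZMod p) H)).symm.toEquiv.sum_comp
      (fun l => c l)
  have hU : ∑ l with l ∈ U.dualAnnihilator, c l
      = Nat.card U.dualAnnihilator * rowMass w (fun v => ∑ i, v i • F i - g ∈ U) := by
    have := sum_weightChar_mem (w := w) U.dualAnnihilator F g
    rw [Subspace.dualAnnihilator_dualCoannihilator_eq] at this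
    rw [← this]
    exact Finset.sum_subtype _ (by simp) c
  have hcard : (Nat.card U : ℝ) * Nat.card U.dualAnnihilator = Nat.card H := by
    rw [← Nat.cast_mul, Nat.card_eq_fintype_card, Nat.card_eq_fintype_card,
      Nat.card_eq_fintype_card, Module.card_eq_pow_finrank (K := ZMod p),
      Module.card_eq_pow_finrank (K := ZMod p) (V := H),
      Module.card_eq_pow_finrank (K := ZMod p) (V := U.dualAnnihilator), ← pow_add,
      Subspace.finrank_add_finrank_dualAnnihilator_eq]
  have hUpos : (0 : ℝ) < Nat.card U := by exact_mod_cast Nat.card_pos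
  have hHpos : (0 : ℝ) < Nat.card H := by exact_mod_cast Nat.card_pos
  have hdiff : ∑ l with l ∉ U.dualAnnihilator, c l
      = ((Nat.card H * (rowMass w (fun v => ∑ i, v i • F i = g)
        - (Nat.card U : ℝ)⁻¹ * rowMass w (fun v => ∑ i, v i • F i - g ∈ U)) : ℝ) : ℂ) := by
    have h1 := Finset.sum_filter_add_sum_filter_not Finset.univ (· ∈ U.dualAnnihilator) c
    rw [hall, hU] at h1
    have h2 : (Nat.card H : ℝ) * (Nat.card U : ℝ)⁻¹ = Nat.card U.dualAnnihilator := by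
      rw [← hcard]; field_simp
    rw [mul_sub, ← mul_assoc, h2]
    push_cast
    rw [← h1]
    ring
  have hterm : ∀ l ∈ Finset.univ.filter (· ∉ U.dualAnnihilator), ‖c l‖ ≤ ρ ^ m := by
    intro l hl
    rw [hc, norm_mul, AddChar.norm_apply, one_mul, norm_prod]
    calc ∏ i, ‖weightChar (w i) (l (F i))‖ ≤ ∏ i, if l (F i) ≠ 0 then ρ else 1 := by
          refine Finset.prod_le_prod (fun _ _ => norm_nonneg _) fun i _ => ?_
          split_ifs with h
          exacts [hρ i _ h, norm_weightChar_le_one (hw i) _]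
      _ = ρ ^ (Finset.univ.filter fun i => l (F i) ≠ 0).card := by
          rw [Finset.prod_ite]; simp
      _ ≤ ρ ^ m := pow_le_pow_of_le_one hρ0 hρ1 (hm l (Finset.mem_filter.1 hl).2)
  have hbound : ‖∑ l with l ∉ U.dualAnnihilator, c l‖ ≤ Nat.card H * ρ ^ m := by
    refine (norm_sum_le_of_le _ hterm).trans ?_
    rw [Finset.sum_const, nsmul_eq_mul]
    refine mul_le_mul_of_nonneg_right ?_ (pow_nonneg hρ0 m)
    have : Nat.card H = Fintype.card (Module.Dual (ZMod p) H) := by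
      rw [Nat.card_eq_fintype_card, Module.card_eq_pow_finrank (K := ZMod p),
        Module.card_eq_pow_finrank (K := ZMod p) (V := Module.Dual (ZMod p) H),
        Subspace.dual_finrank_eq]
    rw [this]
    exact_mod_cast Finset.card_le_univ _
  rw [hdiff, Complex.norm_real, Real.norm_eq_abs, abs_mul, abs_of_pos hHpos] at hbound
  exact le_of_mul_le_mul_left hbound hHpos

end RowMass

section MomentLimit

variable {p : ℕ} [Fact p.Prime] {ι : Type*} [Fintype ι] {H : Type*} [AddCommGroup H]
  [Module (ZMod p) H]

open Classical in
/-- Every family of vectors is robustly spread over some subspace that contains most of it. -/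
theorem exists_subspace_spread [Finite H] (F : ι → H) (m : ℕ) :
    ∃ U : Submodule (ZMod p) H,
      (Finset.univ.filter fun i => F i ∉ U).card ≤ m * Module.finrank (ZMod p) H ∧
      ∀ l : Module.Dual (ZMod p) H, l ∉ U.dualAnnihilator →
        m ≤ (Finset.univ.filter fun i => l (F i) ≠ 0).card := by
  let Q : Submodule (ZMod p) H → Prop := fun U =>
    (Finset.univ.filter fun i => F i ∉ U).card + m * Module.finrank (ZMod p) U
      ≤ m * Module.finrank (ZMod p) H
  have hex : ∃ k, ∃ U, Q U ∧ Module.finrank (ZMod p) U = k :=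
    ⟨_, ⊤, by simp [Q], rfl⟩
  obtain ⟨U, hU, hUk⟩ := Nat.find_spec hex
  refine ⟨U, (Nat.le_add_right _ _).trans hU, fun l hl => ?_⟩
  by_contra! hlt
  have hlt' : U ⊓ LinearMap.ker l < U := by
    refine lt_of_le_of_ne inf_le_left fun h => hl ?_
    rw [Submodule.mem_dualAnnihilator]
    intro w hw
    rw [← h] at hw
    exact hw.2
  have hfr := Submodule.finrank_lt_finrank_of_lt hlt'
  refine Nat.find_min hex (m := Module.finrank (ZMod p) (U ⊓ LinearMap.ker l : Submodule _ _))
    (hUk ▸ hfr) ⟨_, ?_, rfl⟩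
  have hsub : (Finset.univ.filter fun i => F i ∉ U ⊓ LinearMap.ker l)
      ⊆ (Finset.univ.filter fun i => F i ∉ U) ∪ Finset.univ.filter fun i => l (F i) ≠ 0 := by
    intro i hi
    simp only [Finset.mem_filter, Finset.mem_univ, true_and, Finset.mem_union,
      Submodule.mem_inf, LinearMap.mem_ker, not_and_or] at hi ⊢
    exact hi
  have hc := (Finset.card_le_card hsub).trans (Finset.card_union_le _ _)
  have h1 : m * (Module.finrank (ZMod p) (U ⊓ LinearMap.ker l : Submodule _ _) + 1)
      ≤ m * Module.finrank (ZMod p) U := Nat.mul_le_mul_left m hfr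
  have h2 : (Finset.univ.filter fun i => F i ∉ U).card + m * Module.finrank (ZMod p) U
      ≤ m * Module.finrank (ZMod p) H := hU
  change _ + _ ≤ _
  rw [mul_add, mul_one] at h1
  omega

variable [Fintype H] [DecidableEq ι]

open Classical in
theorem card_filter_notMem_le (U : Submodule (ZMod p) H) (M : ℕ) {x : ℝ} (hx0 : 0 < x)
    (hx1 : x ≤ 1) :
    ((Finset.univ.filter fun F : ι → H => (Finset.univ.filter fun i => F i ∉ U).card ≤ M).card : ℝ)
      ≤ x⁻¹ ^ M * (Nat.card U * (1 + x * Fintype.card H)) ^ Fintype.card ι := by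
  have hU1 : (1 : ℝ) ≤ Nat.card U := by exact_mod_cast Nat.card_pos
  have hbase : ∑ g : H, (if g ∈ U then (1 : ℝ) else x) ≤ Nat.card U * (1 + x * Fintype.card H) := by
    calc ∑ g : H, (if g ∈ U then (1 : ℝ) else x) ≤ ∑ g : H, ((if g ∈ U then (1 : ℝ) else 0) + x) :=
          Finset.sum_le_sum fun g _ => by split_ifs <;> linarith
      _ = Nat.card U + x * Fintype.card H := by
          rw [Finset.sum_add_distrib, Finset.sum_ite, Finset.sum_const_zero, add_zero]
          simp only [Finset.sum_const, nsmul_eq_mul, mul_one, Finset.card_univ]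
          rw [← Fintype.card_subtype, Nat.card_eq_fintype_card]
          ring
      _ ≤ _ := by
          have : 0 ≤ x * Fintype.card H := by positivity
          nlinarith
  calc _ = ∑ F : ι → H, if (Finset.univ.filter fun i => F i ∉ U).card ≤ M then (1 : ℝ) else 0 := by
        simp
    _ ≤ ∑ F : ι → H, x⁻¹ ^ M * ∏ i, (if F i ∈ U then (1 : ℝ) else x) := by
        refine Finset.sum_le_sum fun F _ => ?_
        have hprod : ∏ i, (if F i ∈ U then (1 : ℝ) else x)
            = x ^ (Finset.univ.filter fun i => F i ∉ U).card := by
          rw [Finset.prod_ite]; simp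
        rw [hprod]
        split_ifs with h
        · rw [inv_pow, inv_mul_eq_div, one_le_div (by positivity)]
          exact pow_le_pow_of_le_one hx0.le hx1 h
        · positivity
    _ = x⁻¹ ^ M * (∑ g : H, (if g ∈ U then (1 : ℝ) else x)) ^ Fintype.card ι := by
        rw [← Finset.mul_sum, ← Fintype.piFinset_univ,
          ← Finset.prod_univ_sum (fun _ : ι => Finset.univ)
            (fun _ g => if g ∈ U then (1 : ℝ) else x), Finset.prod_const, Finset.card_univ]
    _ ≤ _ := by
        gcongr

theorem abs_prod_sub_pow_le {κ : Type*} (s : Finset κ) {a : κ → ℝ} {b δ : ℝ} (hb : 0 ≤ b)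
    (hδ : 0 ≤ δ) (h : ∀ j ∈ s, |a j - b| ≤ δ) :
    |∏ j ∈ s, a j - b ^ s.card| ≤ (b + δ) ^ s.card - b ^ s.card := by
  classical
  induction s using Finset.induction_on with
  | empty => simp
  | insert j s hj ih =>
    rw [Finset.prod_insert hj, Finset.card_insert_of_notMem hj]
    have h1 := h j (Finset.mem_insert_self _ _)
    have h2 := ih fun i hi => h i (Finset.mem_insert_of_mem hi)
    have h3 : |a j| ≤ b + δ := by
      have := abs_sub_abs_le_abs_sub (a j) b
      rw [abs_of_nonneg hb] at this
      linarith
    have hb' : 0 ≤ b ^ s.card := pow_nonneg hb _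
    calc |a j * ∏ i ∈ s, a i - b ^ (s.card + 1)|
        = |a j * (∏ i ∈ s, a i - b ^ s.card) + (a j - b) * b ^ s.card| := by ring_nf
      _ ≤ |a j| * |∏ i ∈ s, a i - b ^ s.card| + |a j - b| * b ^ s.card := by
          refine (abs_add_le _ _).trans ?_
          rw [abs_mul, abs_mul, abs_of_nonneg hb']
      _ ≤ (b + δ) * ((b + δ) ^ s.card - b ^ s.card) + δ * b ^ s.card := by
          gcongr
      _ = _ := by ring

/-- The expected number of spanning families `F` in `H` such that, for every `j`, the `j`-th row
of a random matrix combines `F` to the prescribed vector `T (F j)`. -/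
noncomputable def spanningMoment (w : ι → ι → ZMod p → ℝ) (T : H → H) : ℝ :=
  open Classical in
  ∑ F : ι → H, if Submodule.span (ZMod p) (Set.range F) = ⊤ then
    ∏ j, rowMass (w j) (fun v => ∑ i, v i • F i = T (F j)) else 0

open Classical in
theorem abs_spanningMoment_sub_one_le {ε ρ c θ x : ℝ} {w : ι → ι → ZMod p → ℝ}
    (hw : ∀ j i, IsBalancedWeight ε (w j i)) (T : H → H)
    (hρ0 : 0 ≤ ρ) (hρ1 : ρ ≤ 1) (hρ : ∀ j i a, a ≠ 0 → ‖weightChar (w j i) a‖ ≤ ρ)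
    {m : ℕ} (hm : 0 < m) (hx0 : 0 < x) (hx1 : x ≤ 1) (hxθ : 1 + x * Fintype.card H ≤ θ)
    (hmθ : x⁻¹ ^ (m * Module.finrank (ZMod p) H) ≤ θ ^ Fintype.card ι)
    (hρm : Fintype.card H * ρ ^ m ≤ ε / 2) (hc1 : 1 - ε / 2 ≤ c) (hc2 : 1 / 2 ≤ c) :
    |spanningMoment w T - 1| ≤ ((1 + Fintype.card H * ρ ^ m) ^ Fintype.card ι - 1)
      + 2 * (Nat.card (Submodule (ZMod p) H) * (θ ^ 2 * c) ^ Fintype.card ι) := by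
  set n := Fintype.card ι with hn
  set h : ℝ := (Fintype.card H : ℝ) with hh
  have hhpos : 0 < h := by rw [hh]; exact_mod_cast Fintype.card_pos
  have hθ : 1 ≤ θ := le_trans (by nlinarith [mul_pos hx0 hhpos]) hxθ
  let code : (ι → H) → Prop := fun F => ∀ l : Module.Dual (ZMod p) H, l ≠ 0 →
    m ≤ (Finset.univ.filter fun i => l (F i) ≠ 0).card
  let span : (ι → H) → Prop := fun F => Submodule.span (ZMod p) (Set.range F) = ⊤
  let P : (ι → H) → ℝ := fun F => ∏ j, rowMass (w j) (fun v => ∑ i, v i • F i = T (F j))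
  let B : Submodule (ZMod p) H → (ι → H) → Prop := fun U F =>
    (Finset.univ.filter fun i => F i ∉ U).card ≤ m * Module.finrank (ZMod p) H
  let D : Submodule (ZMod p) H → (ι → H) → Prop := fun U F =>
    ∀ l : Module.Dual (ZMod p) H, l ∉ U.dualAnnihilator →
        m ≤ (Finset.univ.filter fun i => l (F i) ≠ 0).card
  have hcode_span : ∀ F, code F → span F := by
    intro F hF
    by_contra hne
    obtain ⟨l, hl0, hl⟩ := Submodule.exists_le_ker_of_lt_top _ (lt_top_iff_ne_top.2 hne)
    have := hF l hl0
    rw [Finset.filter_false_of_mem, Finset.card_empty] at this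
    · omega
    · intro i _
      simpa using hl (Submodule.subset_span ⟨i, rfl⟩)
  have hnoncode : ∀ F, ¬ code F → ∃ U : Submodule (ZMod p) H, U ≠ ⊤ ∧ B U F ∧ D U F := by
    intro F hF
    obtain ⟨U, h1, h2⟩ := exists_subspace_spread (p := p) F m
    refine ⟨U, ?_, h1, h2⟩
    rintro rfl
    refine hF fun l hl => h2 l ?_
    simpa using hl
  have hcardB : ∀ U : Submodule (ZMod p) H,
      ((Finset.univ.filter fun F => B U F).card : ℝ) ≤ (θ ^ 2 * Nat.card U) ^ n := by
    intro U
    refine (card_filter_notMem_le U _ hx0 hx1).trans ?_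
    calc _ ≤ θ ^ n * (Nat.card U * θ) ^ n := by gcongr
      _ = _ := by rw [← mul_pow]; ring
  have hP0 : ∀ F, 0 ≤ P F := fun F => Finset.prod_nonneg fun j _ => rowMass_nonneg (hw j) _
  have hcodeP : ∀ F, code F → |P F - h⁻¹ ^ n| ≤ (h⁻¹ + ρ ^ m) ^ n - h⁻¹ ^ n := by
    intro F hF
    refine abs_prod_sub_pow_le Finset.univ (inv_nonneg.2 hhpos.le) (pow_nonneg hρ0 m) fun j _ => ?_
    have := abs_rowMass_sub_le (hw j) hρ0 hρ1 (hρ j) F ⊤ m (fun l hl => hF l (by simpa using hl))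
      (T (F j))
    rw [rowMass_true (hw j) (Q := fun v => ∑ i, v i • F i - T (F j) ∈ (⊤ : Submodule (ZMod p) H))
      (fun _ => Submodule.mem_top), mul_one] at this
    rwa [Nat.card_congr (Submodule.topEquiv (R := ZMod p) (M := H)).toEquiv,
      Nat.card_eq_fintype_card] at this
  have hnonP : ∀ (U : Submodule (ZMod p) H) F, U ≠ ⊤ → D U F → span F →
      P F ≤ ((Nat.card U : ℝ)⁻¹ * c) ^ n := by
    intro U F hU hD hs
    have hUpos : (0 : ℝ) < Nat.card U := by exact_mod_cast Nat.card_pos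
    obtain ⟨i₀, hi₀⟩ : ∃ i, F i ∉ U := by
      by_contra! hall
      refine hU (top_le_iff.1 (hs ▸ Submodule.span_le.2 ?_))
      rintro _ ⟨i, rfl⟩
      exact hall i
    refine (Finset.prod_le_prod (g := fun _ => (Nat.card U : ℝ)⁻¹ * c)
      (fun j _ => rowMass_nonneg (hw j) _) fun j _ => ?_).trans_eq (by simp [hn])
    have h1 := (abs_le.1 (abs_rowMass_sub_le (hw j) hρ0 hρ1 (hρ j) F U m hD (T (F j)))).2
    have h2 := rowMass_mem_le (hw j) F U (T (F j)) hi₀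
    have h3 : ρ ^ m ≤ (Nat.card U : ℝ)⁻¹ * (h * ρ ^ m) := by
      rw [← mul_assoc]
      refine le_mul_of_one_le_left (pow_nonneg hρ0 m) ?_
      rw [inv_mul_eq_div, one_le_div hUpos, hh, ← Nat.card_eq_fintype_card]
      exact_mod_cast Nat.card_le_card_of_injective _ U.subtype_injective
    have h4 : (Nat.card U : ℝ)⁻¹ * rowMass (w j) (fun v => ∑ i, v i • F i - T (F j) ∈ U)
        ≤ (Nat.card U : ℝ)⁻¹ * (1 - ε) := by gcongr
    have h5 : (Nat.card U : ℝ)⁻¹ * (h * ρ ^ m) ≤ (Nat.card U : ℝ)⁻¹ * (ε / 2) := by gcongr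
    have h6 : (Nat.card U : ℝ)⁻¹ * (1 - ε / 2) ≤ (Nat.card U : ℝ)⁻¹ * c := by gcongr
    linarith
  have hUhalf : ∀ U : Submodule (ZMod p) H, U ≠ ⊤ → (Nat.card U : ℝ) ≤ c * h := by
    intro U hU
    have h1 : Nat.card U * U.toAddSubgroup.index = Nat.card H :=
      U.toAddSubgroup.card_mul_index
    have h2 : U.toAddSubgroup.index ≠ 1 := by
      rw [Ne, AddSubgroup.index_eq_one]
      intro h
      exact hU (Submodule.toAddSubgroup_injective (by rw [h]; rfl))
    have h3 : U.toAddSubgroup.index ≠ 0 := by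
      intro h0
      rw [h0, mul_zero] at h1
      exact Nat.card_pos.ne h1
    have h4 : Nat.card U * 2 ≤ Nat.card H := by
      rw [← h1]; exact Nat.mul_le_mul_left _ (by omega)
    have h5 : (Nat.card U : ℝ) * 2 ≤ h := by
      rw [hh, ← Nat.card_eq_fintype_card]; exact_mod_cast h4
    nlinarith
  have hcard_union : ∀ (f : (ι → H) → ℝ) (g : Submodule (ZMod p) H → ℝ),
      (∀ U F, U ≠ ⊤ → B U F → D U F → f F ≤ g U) → (∀ U, 0 ≤ g U) →
      (∀ U, U ≠ ⊤ → g U * (θ ^ 2 * Nat.card U) ^ n ≤ (θ ^ 2 * c) ^ n) →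
      ∑ F with ¬ code F, f F ≤ Nat.card (Submodule (ZMod p) H) * (θ ^ 2 * c) ^ n := by
    intro f g hfg hg0 hg
    have : Fintype (Submodule (ZMod p) H) := Fintype.ofFinite _
    calc ∑ F with ¬ code F, f F
        ≤ ∑ F with ¬ code F, ∑ U with U ≠ ⊤, (if B U F then g U else 0) := by
          refine Finset.sum_le_sum fun F hF => ?_
          obtain ⟨U, hU, hB, hD⟩ := hnoncode F (Finset.mem_filter.1 hF).2
          refine (hfg U F hU hB hD).trans ?_
          have := Finset.single_le_sum (s := Finset.univ.filter fun U => U ≠ ⊤)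
            (f := fun U => if B U F then g U else 0)
            (fun U _ => by split_ifs; exacts [hg0 U, le_rfl])
            (Finset.mem_filter.2 ⟨Finset.mem_univ U, hU⟩)
          simpa [hB] using this
      _ ≤ ∑ F, ∑ U with U ≠ ⊤, (if B U F then g U else 0) :=
          Finset.sum_le_sum_of_subset_of_nonneg (Finset.filter_subset _ _) fun F _ _ =>
            Finset.sum_nonneg fun U _ => by split_ifs; exacts [hg0 U, le_rfl]
      _ = ∑ U with U ≠ ⊤, g U * (Finset.univ.filter fun F => B U F).card := by
          rw [Finset.sum_comm]
          refine Finset.sum_congr rfl fun U _ => ?_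
          rw [← Finset.sum_filter, Finset.sum_const, nsmul_eq_mul, mul_comm]
      _ ≤ ∑ U with U ≠ ⊤, (θ ^ 2 * c) ^ n :=
          Finset.sum_le_sum fun U hU =>
            (mul_le_mul_of_nonneg_left (hcardB U) (hg0 U)).trans (hg U (Finset.mem_filter.1 hU).2)
      _ ≤ Nat.card (Submodule (ZMod p) H) * (θ ^ 2 * c) ^ n := by
          rw [Finset.sum_const, nsmul_eq_mul]
          have : 0 ≤ (θ ^ 2 * c) ^ n := by positivity
          refine mul_le_mul_of_nonneg_right ?_ this
          rw [Nat.card_eq_fintype_card]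
          exact_mod_cast Finset.card_le_univ _
  have hsplit : spanningMoment w T - 1 = ∑ F with code F, (P F - h⁻¹ ^ n)
      + (∑ F with ¬ code F, (if span F then P F else 0) - ∑ F with ¬ code F, h⁻¹ ^ n) := by
    have e1 : ∑ F : ι → H, h⁻¹ ^ n = 1 := by
      rw [Finset.sum_const, Finset.card_univ, Fintype.card_fun, nsmul_eq_mul, inv_pow]
      push_cast
      exact mul_inv_cancel₀ (pow_pos hhpos _).ne'
    have e2 : spanningMoment w T = ∑ F with code F, P F
        + ∑ F with ¬ code F, (if span F then P F else 0) := by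
      rw [spanningMoment, ← Finset.sum_filter_add_sum_filter_not Finset.univ code]
      congr 1
      exact Finset.sum_congr rfl fun F hF => if_pos (hcode_span F (Finset.mem_filter.1 hF).2)
    rw [e2, ← e1, ← Finset.sum_filter_add_sum_filter_not Finset.univ code (fun _ => h⁻¹ ^ n),
      Finset.sum_sub_distrib]
    ring
  have hmain : |∑ F with code F, (P F - h⁻¹ ^ n)| ≤ (1 + h * ρ ^ m) ^ n - 1 := by
    calc _ ≤ ∑ F with code F, |P F - h⁻¹ ^ n| := Finset.abs_sum_le_sum_abs _ _
      _ ≤ ∑ F with code F, ((h⁻¹ + ρ ^ m) ^ n - h⁻¹ ^ n) :=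
          Finset.sum_le_sum fun F hF => hcodeP F (Finset.mem_filter.1 hF).2
      _ ≤ h ^ n * ((h⁻¹ + ρ ^ m) ^ n - h⁻¹ ^ n) := by
          rw [Finset.sum_const, nsmul_eq_mul]
          refine mul_le_mul_of_nonneg_right ?_ ?_
          · rw [hh, hn]
            exact_mod_cast (Finset.card_le_univ _).trans_eq Fintype.card_fun
          · rw [sub_nonneg]
            gcongr
            exact le_add_of_nonneg_right (pow_nonneg hρ0 m)
      _ = _ := by
          rw [mul_sub, ← mul_pow, ← mul_pow, mul_add, mul_inv_cancel₀ hhpos.ne', one_pow]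
  have hB1 : ∑ F with ¬ code F, (if span F then P F else 0)
      ≤ Nat.card (Submodule (ZMod p) H) * (θ ^ 2 * c) ^ n := by
    refine hcard_union _ (fun U => ((Nat.card U : ℝ)⁻¹ * c) ^ n) (fun U F hU _ hD => ?_)
      (fun U => by positivity) fun U _ => ?_
    · split_ifs with hs
      exacts [hnonP U F hU hD hs, by positivity]
    · have hUpos : (0 : ℝ) < Nat.card U := by exact_mod_cast Nat.card_pos
      rw [← mul_pow]
      refine le_of_eq ?_
      congr 1
      field_simp
  have hB2 : ∑ F : ι → H with ¬ code F, h⁻¹ ^ n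
      ≤ Nat.card (Submodule (ZMod p) H) * (θ ^ 2 * c) ^ n := by
    refine hcard_union _ (fun U => h⁻¹ ^ n) (fun U F hU _ hD => le_rfl)
      (fun U => by positivity) fun U hU => ?_
    rw [← mul_pow]
    refine pow_le_pow_left₀ (by positivity) ?_ n
    rw [inv_mul_le_iff₀ hhpos]
    nlinarith [hUhalf U hU, pow_pos (one_pos.trans_le hθ) 2]
  have hB1' : 0 ≤ ∑ F with ¬ code F, (if span F then P F else 0) :=
    Finset.sum_nonneg fun F _ => by split_ifs; exacts [hP0 F, le_rfl]
  have hB2' : 0 ≤ ∑ F : ι → H with ¬ code F, h⁻¹ ^ n :=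
    Finset.sum_nonneg fun F _ => by positivity
  rw [hsplit]
  rw [abs_le] at hmain ⊢
  constructor <;> linarith [hmain.1, hmain.2]

theorem tendsto_spanningMoment {ε : ℝ} (hε : 0 < ε) {w : ∀ n, Fin n → Fin n → ZMod p → ℝ}
    (hw : ∀ n j i, IsBalancedWeight ε (w n j i)) (T : H → H) :
    Tendsto (fun n => spanningMoment (w n) T) atTop (𝓝 1) := by
  obtain ⟨ρ, hρ0, hρ1, hρ⟩ := exists_norm_weightChar_le (p := p) hε
  set h : ℝ := (Fintype.card H : ℝ) with hh
  have hhpos : 1 ≤ h := by rw [hh]; exact_mod_cast Fintype.card_pos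
  obtain ⟨c, hc1, hc2, hclt⟩ : ∃ c : ℝ, 1 - ε / 2 ≤ c ∧ 1 / 2 ≤ c ∧ c < 1 :=
    ⟨max (1 - ε / 2) (1 / 2), le_max_left _ _, le_max_right _ _,
      max_lt (by linarith) (by norm_num)⟩
  set θ : ℝ := 1 + (1 - c) / 4 with hθ
  set x : ℝ := (1 - c) / 4 / h with hx
  have hx0 : 0 < x := div_pos (by linarith) (by linarith)
  have hx1 : x ≤ 1 := by
    rw [hx, div_le_one (by linarith)]; linarith
  have hxθ : 1 + x * h ≤ θ := by
    rw [hx, div_mul_cancel₀ _ (by linarith)]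
  have hθc : θ ^ 2 * c < 1 := by
    have ht : 0 < (1 - c) / 4 := by linarith
    have h1 : θ ^ 2 * c = 1 - (2 * ((1 - c) / 4) + 7 * ((1 - c) / 4) ^ 2
        + 4 * ((1 - c) / 4) ^ 3) := by rw [hθ]; ring
    rw [h1]
    linarith [pow_pos ht 2, pow_pos ht 3]
  have hθ1 : 1 < θ := by rw [hθ]; linarith
  obtain ⟨N₀, hN₀⟩ := pow_unbounded_of_one_lt (x⁻¹ ^ Module.finrank (ZMod p) H) hθ1
  set N := N₀ + 1 with hN
  have hNθ : x⁻¹ ^ Module.finrank (ZMod p) H ≤ θ ^ N :=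
    hN₀.le.trans (pow_le_pow_right₀ hθ1.le (by omega))
  have hdiv : Tendsto (fun n : ℕ => n / N) atTop atTop :=
    Nat.tendsto_div_const_atTop (by omega)
  have hρpow : Tendsto (fun n : ℕ => h * ρ ^ (n / N)) atTop (𝓝 0) := by
    simpa using ((tendsto_pow_atTop_nhds_zero_of_lt_one hρ0 hρ1).comp hdiv).const_mul h
  have hnρ : Tendsto (fun n : ℕ => n * (h * ρ ^ (n / N))) atTop (𝓝 0) := by
    have h1 : Tendsto (fun k : ℕ => N * h * ((k : ℝ) * ρ ^ k + ρ ^ k)) atTop (𝓝 0) := by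
      simpa using ((tendsto_self_mul_const_pow_of_lt_one hρ0 hρ1).add
        (tendsto_pow_atTop_nhds_zero_of_lt_one hρ0 hρ1)).const_mul (N * h)
    refine squeeze_zero (fun n => by positivity) (fun n => ?_) (h1.comp hdiv)
    have h2 : (n : ℝ) ≤ N * ((n / N : ℕ) + 1) := by
      exact_mod_cast (Nat.lt_mul_div_succ n (by omega)).le
    calc (n : ℝ) * (h * ρ ^ (n / N)) ≤ (N * ((n / N : ℕ) + 1)) * (h * ρ ^ (n / N)) := by gcongr
      _ = _ := by simp only [Function.comp]; ring
  have hmain : Tendsto (fun n : ℕ => (1 + h * ρ ^ (n / N)) ^ n - 1) atTop (𝓝 0) := by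
    have h1 : Tendsto (fun n : ℕ => Real.exp (n * (h * ρ ^ (n / N))) - 1) atTop (𝓝 0) := by
      simpa using ((Real.continuous_exp.tendsto 0).comp hnρ).sub_const 1
    refine squeeze_zero (fun n => ?_) (fun n => ?_) h1
    · rw [sub_nonneg]
      exact one_le_pow₀ (le_add_of_nonneg_right (by positivity))
    · rw [Real.exp_nat_mul]
      gcongr
      linarith [Real.add_one_le_exp (h * ρ ^ (n / N))]
  have hpow : Tendsto (fun n : ℕ => 2 * (Nat.card (Submodule (ZMod p) H) * (θ ^ 2 * c) ^ n))
      atTop (𝓝 0) := by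
    have := ((tendsto_pow_atTop_nhds_zero_of_lt_one (by positivity) hθc).const_mul
      (Nat.card (Submodule (ZMod p) H) : ℝ)).const_mul 2
    simpa using this
  have hbound := hmain.add hpow
  rw [add_zero] at hbound
  rw [← tendsto_sub_nhds_zero_iff]
  refine squeeze_zero_norm' ?_ hbound
  filter_upwards [hdiv.eventually_ge_atTop 1, hρpow.eventually_le_const (half_pos hε)] with n h1 h2
  rw [Real.norm_eq_abs]
  have h3 : x⁻¹ ^ (n / N * Module.finrank (ZMod p) H) ≤ θ ^ Fintype.card (Fin n) := by
    rw [mul_comm, pow_mul, Fintype.card_fin]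
    calc _ ≤ (θ ^ N) ^ (n / N) := by gcongr
      _ = θ ^ (N * (n / N)) := by rw [pow_mul]
      _ ≤ θ ^ n := pow_le_pow_right₀ hθ1.le (Nat.mul_div_le _ _)
  have := abs_spanningMoment_sub_one_le (hw n) T hρ0 hρ1.le (fun j i a ha => hρ _ (hw n j i) a ha)
    h1 hx0 hx1 hxθ h3 h2 hc1 hc2
  simpa using this

end MomentLimit

section MatrixExpectation

variable {p : ℕ} [Fact p.Prime] {n : ℕ}

/-- The expectation of a function of a random matrix with independent entries, the `(i, j)` entry
having the probability vector `w i j`. -/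
noncomputable def matrixExp (w : Fin n → Fin n → ZMod p → ℝ)
    (g : Matrix (Fin n) (Fin n) (ZMod p) → ℝ) : ℝ :=
  ∑ M : Matrix (Fin n) (Fin n) (ZMod p), (∏ i, ∏ j, w i j (M i j)) * g M

theorem isBalancedWeight_of_isBalanced {Ω : Type*} [MeasurableSpace Ω] {P : Measure Ω}
    [IsProbabilityMeasure P] {ε : ℝ} {ξ : Ω → ZMod p} (hm : Measurable ξ)
    (hξ : IsBalanced P ε ξ) : IsBalancedWeight ε fun x => P.real {ω | ξ ω = x} where
  nonneg _ := measureReal_nonneg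
  le := hξ
  sum_eq_one := by
    have h : ⋃ x ∈ (Finset.univ : Finset (ZMod p)), {ω | ξ ω = x} = Set.univ := by
      ext ω; simp
    rw [← measureReal_biUnion_finset, h, probReal_univ]
    · intro x _ y _ hxy
      exact Set.disjoint_left.2 fun ω hx hy => hxy (hx.symm.trans hy)
    · exact fun x _ => hm (measurableSet_singleton x)

open Classical in
theorem measureReal_eq_matrixExp {Ω : Type*} [MeasurableSpace Ω] (P : Measure Ω)
    [IsProbabilityMeasure P] (A : Ω → Matrix (Fin n) (Fin n) (ZMod p))
    (hmeas : ∀ i j, Measurable fun ω => A ω i j)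
    (hindep : iIndepFun (fun (ij : Fin n × Fin n) (ω : Ω) => A ω ij.1 ij.2) P)
    (Q : Matrix (Fin n) (Fin n) (ZMod p) → Prop) :
    P.real {ω | Q (A ω)}
      = matrixExp (fun i j x => P.real {ω | A ω i j = x}) fun M => if Q M then 1 else 0 := by
  have hset : ∀ M, {ω | A ω = M} = ⋂ ij ∈ (Finset.univ : Finset (Fin n × Fin n)),
      (fun ω => A ω ij.1 ij.2) ⁻¹' {M ij.1 ij.2} := by
    intro M
    ext ω
    simp [← Matrix.ext_iff]
  have hM : ∀ M, P.real {ω | A ω = M} = ∏ i, ∏ j, P.real {ω | A ω i j = M i j} := by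
    intro M
    rw [hset, measureReal_def, hindep.measure_inter_preimage_eq_mul _
      fun ij _ => measurableSet_singleton _, ENNReal.toReal_prod, Fintype.prod_prod_type]
    rfl
  have hmeasM : ∀ M, MeasurableSet {ω | A ω = M} := by
    intro M
    rw [hset]
    exact Finset.measurableSet_biInter _ fun ij _ => hmeas ij.1 ij.2 (measurableSet_singleton _)
  have hQ : {ω | Q (A ω)} = ⋃ M ∈ Finset.univ.filter Q, {ω | A ω = M} := by
    ext ω; simp
  rw [hQ, measureReal_biUnion_finset, Finset.sum_filter, matrixExp]
  · refine Finset.sum_congr rfl fun M _ => ?_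
    rw [hM, mul_ite, mul_one, mul_zero]
  · intro x _ y _ hxy
    exact Set.disjoint_left.2 fun ω hx hy => hxy (hx.symm.trans hy)
  · exact fun M _ => hmeasM M

theorem matrixExp_const_mul (w : Fin n → Fin n → ZMod p → ℝ) (c : ℝ)
    (g : Matrix (Fin n) (Fin n) (ZMod p) → ℝ) :
    matrixExp w (fun M => c * g M) = c * matrixExp w g := by
  simp only [matrixExp, Finset.mul_sum, mul_left_comm]

theorem matrixExp_sum {κ : Type*} (w : Fin n → Fin n → ZMod p → ℝ) (s : Finset κ)
    (g : κ → Matrix (Fin n) (Fin n) (ZMod p) → ℝ) :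
    matrixExp w (fun M => ∑ k ∈ s, g k M) = ∑ k ∈ s, matrixExp w (g k) := by
  simp only [matrixExp, Finset.mul_sum]
  exact Finset.sum_comm

theorem abs_matrixExp_sub_le {w : Fin n → Fin n → ZMod p → ℝ} (hw : ∀ i j x, 0 ≤ w i j x)
    {g g' b : Matrix (Fin n) (Fin n) (ZMod p) → ℝ} (h : ∀ M, |g M - g' M| ≤ b M) :
    |matrixExp w g - matrixExp w g'| ≤ matrixExp w b := by
  simp only [matrixExp, ← Finset.sum_sub_distrib, ← mul_sub]
  refine (Finset.abs_sum_le_sum_abs _ _).trans (Finset.sum_le_sum fun M _ => ?_)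
  have h0 : 0 ≤ ∏ i, ∏ j, w i j (M i j) :=
    Finset.prod_nonneg fun i _ => Finset.prod_nonneg fun j _ => hw i j _
  rw [abs_mul, abs_of_nonneg h0]
  exact mul_le_mul_of_nonneg_left (h M) h0

end MatrixExpectation

/-- Surjective linear maps that intertwine two endomorphisms. -/
def SurjIntertwiner {K X H : Type*} [Semiring K] [AddCommMonoid X] [Module K X] [AddCommMonoid H]
    [Module K H] (a : X →ₗ[K] X) (T : H →ₗ[K] H) : Type _ :=
  {F : X →ₗ[K] H // Function.Surjective F ∧ ∀ x, F (a x) = T (F x)}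

instance {K X H : Type*} [Semiring K] [AddCommMonoid X] [Module K X] [AddCommMonoid H]
    [Module K H] [Finite X] [Finite H] (a : X →ₗ[K] X) (T : H →ₗ[K] H) :
    Finite (SurjIntertwiner a T) :=
  Finite.of_injective (fun F : SurjIntertwiner a T => (F.1 : X → H))
    fun _ _ h => Subtype.ext (DFunLike.coe_injective h)

section

variable {p : ℕ} [Fact p.Prime] {n : ℕ} {H : Type*} [AddCommGroup H] [Module (ZMod p) H]
  [Fintype H]

open Classical in
theorem card_surjIntertwiner_vecMulLinear (M : Matrix (Fin n) (Fin n) (ZMod p))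
    (T : H →ₗ[ZMod p] H) :
    (Nat.card (SurjIntertwiner M.vecMulLinear T) : ℝ)
      = ∑ F : Fin n → H, if Submodule.span (ZMod p) (Set.range F) = ⊤ ∧
          ∀ j, ∑ i, M j i • F i = T (F j) then 1 else 0 := by
  let e : (Fin n → H) ≃ ((Fin n → ZMod p) →ₗ[ZMod p] H) :=
    ((Pi.basisFun (ZMod p) (Fin n)).constr ℕ).toEquiv
  have he : ∀ F v, e F v = ∑ i, v i • F i := by
    intro F v
    simp [e, Module.Basis.constr_apply_fintype]
  have hsurj : ∀ F, Function.Surjective (e F) ↔ Submodule.span (ZMod p) (Set.range F) = ⊤ := by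
    intro F
    rw [← LinearMap.range_eq_top]
    have : LinearMap.range (e F) = Submodule.span (ZMod p) (Set.range F) :=
      Module.Basis.constr_range (S := ℕ) (Pi.basisFun (ZMod p) (Fin n))
    rw [this]
  have hT : ∀ F, (∀ v, e F (M.vecMulLinear v) = T (e F v)) ↔ ∀ j, ∑ i, M j i • F i = T (F j) := by
    intro F
    have h1 : (∀ v, e F (M.vecMulLinear v) = T (e F v)) ↔
        (e F) ∘ₗ M.vecMulLinear = T ∘ₗ (e F) := by
      rw [LinearMap.ext_iff]; rfl
    rw [h1]
    constructor
    · intro h j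
      have := LinearMap.congr_fun h (Pi.single j 1)
      simpa [he, Matrix.single_one_vecMul, Pi.single_apply] using this
    · intro h
      refine (Pi.basisFun (ZMod p) (Fin n)).ext fun j => ?_
      simpa [he, Matrix.single_one_vecMul, Pi.single_apply] using h j
  have hcard : Nat.card (SurjIntertwiner M.vecMulLinear T)
      = Nat.card {F : Fin n → H // Submodule.span (ZMod p) (Set.range F) = ⊤ ∧
          ∀ j, ∑ i, M j i • F i = T (F j)} :=
    Nat.card_congr (e.subtypeEquiv fun F => and_congr (hsurj F).symm (hT F).symm).symm
  rw [hcard, Nat.card_eq_fintype_card, Fintype.card_subtype, Finset.sum_boole]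

theorem matrixExp_card_surjIntertwiner (w : Fin n → Fin n → ZMod p → ℝ) (T : H →ₗ[ZMod p] H) :
    matrixExp w (fun M => (Nat.card (SurjIntertwiner M.vecMulLinear T) : ℝ))
      = spanningMoment w T := by
  classical
  simp only [card_surjIntertwiner_vecMulLinear, matrixExp_sum]
  refine Finset.sum_congr rfl fun F _ => ?_
  split_ifs with hF
  · have : ∀ j, rowMass (w j) (fun v => ∑ i, v i • F i = T (F j))
        = ∑ v : Fin n → ZMod p, (∏ i, w j i (v i)) *
          if ∑ i, v i • F i = T (F j) then 1 else 0 := fun j => by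
      simp only [rowMass, mul_ite, mul_one, mul_zero]
    simp only [this]
    rw [Finset.prod_univ_sum, Fintype.piFinset_univ, matrixExp]
    refine Finset.sum_congr rfl fun M _ => ?_
    rw [Finset.prod_mul_distrib]
    congr 1
    rw [Finset.prod_boole]
    simp [hF]
  · simp [matrixExp, hF]

theorem tendsto_matrixExp_card_surjIntertwiner {ε : ℝ} (hε : 0 < ε)
    {w : ∀ n, Fin n → Fin n → ZMod p → ℝ} (hw : ∀ n j i, IsBalancedWeight ε (w n j i))
    (T : H →ₗ[ZMod p] H) :
    Tendsto (fun n => matrixExp (w n) fun M =>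
      (Nat.card (SurjIntertwiner M.vecMulLinear T) : ℝ)) atTop (𝓝 1) := by
  simp only [matrixExp_card_surjIntertwiner]
  exact tendsto_spanningMoment hε hw T

end

section EulerCoeff

/-- The coefficients `∏_{i = 1}^e (1 - q ^ i)⁻¹` of Euler's expansion of `∏_{j ≥ 1} (1 - q ^ (-j))`. -/
noncomputable def eulerCoeff (q : ℝ) (e : ℕ) : ℝ :=
  ∏ i ∈ Finset.range e, (1 - q ^ (i + 1))⁻¹

theorem eulerCoeff_succ (q : ℝ) (e : ℕ) :
    eulerCoeff q (e + 1) = eulerCoeff q e * (1 - q ^ (e + 1))⁻¹ :=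
  Finset.prod_range_succ _ _

theorem one_sub_pow_succ_ne_zero {q : ℝ} (hq : 1 < q) (i : ℕ) : 1 - q ^ (i + 1) ≠ 0 :=
  sub_ne_zero.2 (one_lt_pow₀ hq i.succ_ne_zero).ne

theorem sum_eulerCoeff_mul_prod {q : ℝ} (hq : 1 < q) (x : ℝ) (m : ℕ) :
    ∑ e ∈ Finset.range (m + 1), eulerCoeff q e * ∏ i ∈ Finset.range e, (x - q ^ i)
      = eulerCoeff q m * ∏ i ∈ Finset.range m, (x - q ^ (i + 1)) := by
  induction m with
  | zero => simp
  | succ m ih =>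
    rw [Finset.sum_range_succ, ih, Finset.prod_range_succ', Finset.prod_range_succ, eulerCoeff_succ]
    have := one_sub_pow_succ_ne_zero hq m
    field_simp
    ring

/-- Truncations of the alternating sum detect whether `d = 0` up to the last term. -/
theorem abs_indicator_sub_sum_eulerCoeff_le {q : ℝ} (hq : 1 < q) (d m : ℕ) :
    |(if d = 0 then 1 else 0) - ∑ e ∈ Finset.range (m + 1),
        eulerCoeff q e * ∏ i ∈ Finset.range e, (q ^ d - q ^ i)|
      ≤ |eulerCoeff q m| * ∏ i ∈ Finset.range m, (q ^ d - q ^ i) := by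
  have hnn : ∀ (m : ℕ), 0 ≤ ∏ i ∈ Finset.range m, (q ^ d - q ^ i) := by
    intro m
    by_cases h : d < m
    · rw [Finset.prod_eq_zero (Finset.mem_range.2 h) (sub_self _)]
    · refine Finset.prod_nonneg fun i hi => sub_nonneg.2 (pow_le_pow_right₀ hq.le ?_)
      have := Finset.mem_range.1 hi
      omega
  rw [sum_eulerCoeff_mul_prod hq]
  rcases Nat.eq_zero_or_pos d with rfl | hd
  · have : eulerCoeff q m * ∏ i ∈ Finset.range m, (q ^ 0 - q ^ (i + 1)) = 1 := by
      rw [eulerCoeff, ← Finset.prod_mul_distrib]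
      exact Finset.prod_eq_one fun i _ => by
        rw [pow_zero, inv_mul_cancel₀ (one_sub_pow_succ_ne_zero hq i)]
    rw [this]
    simpa using mul_nonneg (abs_nonneg _) (hnn m)
  · rw [if_neg hd.ne', zero_sub, abs_neg, abs_mul]
    refine mul_le_mul_of_nonneg_left ?_ (abs_nonneg _)
    by_cases h : d ≤ m
    · rw [Finset.prod_eq_zero (i := d - 1) (Finset.mem_range.2 (by omega)), abs_zero]
      · exact hnn m
      · rw [Nat.sub_add_cancel hd, sub_self]
    · rw [abs_of_nonneg]
      · refine Finset.prod_le_prod (fun i hi => ?_) fun i hi => ?_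
        · have := Finset.mem_range.1 hi
          exact sub_nonneg.2 (pow_le_pow_right₀ hq.le (by omega))
        · have : q ^ i ≤ q ^ (i + 1) := pow_le_pow_right₀ hq.le (by omega)
          linarith
      · refine Finset.prod_nonneg fun i hi => ?_
        have := Finset.mem_range.1 hi
        exact sub_nonneg.2 (pow_le_pow_right₀ hq.le (by omega))

end EulerCoeff

section ResidueField

variable {R k : Type*} [CommRing R] [Field k] [Algebra R k] {N : Type*} [AddCommGroup N]
  [Module R N]

theorem surjective_pi_iff_linearIndependent (hk : Function.Surjective (algebraMap R k)) {e : ℕ}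
    (ψ : Fin e → (N →ₗ[R] k)) :
    Function.Surjective (LinearMap.pi ψ) ↔ LinearIndependent k ψ := by
  constructor
  · intro h
    rw [Fintype.linearIndependent_iff]
    intro c hc i
    obtain ⟨x, hx⟩ := h (Pi.single i 1)
    have h1 := LinearMap.congr_fun hc x
    have h2 : ∀ j, ψ j x = Pi.single (M := fun _ => k) i 1 j := fun j => congrFun hx j
    simpa [h2, Pi.single_apply] using h1
  · intro h
    let W : Submodule k (Fin e → k) :=
      { carrier := Set.range (LinearMap.pi ψ)
        add_mem' := by
          rintro _ _ ⟨x, rfl⟩ ⟨y, rfl⟩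
          exact ⟨x + y, map_add _ _ _⟩
        zero_mem' := ⟨0, map_zero _⟩
        smul_mem' := by
          rintro c _ ⟨x, rfl⟩
          obtain ⟨r, rfl⟩ := hk c
          exact ⟨r • x, by rw [map_smul, algebraMap_smul]⟩ }
    by_contra hns
    have hW : W ≠ ⊤ := fun hW => hns fun v => by
      have : v ∈ W := hW ▸ Submodule.mem_top
      exact this
    obtain ⟨l, hl0, hl⟩ := Submodule.exists_le_ker_of_lt_top W (lt_top_iff_ne_top.2 hW)
    refine hl0 ?_
    rw [Fintype.linearIndependent_iff] at h
    have hrep : ∀ v, l v = ∑ i, l (Pi.single i 1) * v i := by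
      intro v
      conv_lhs => rw [← Finset.univ_sum_single v]
      rw [map_sum]
      refine Finset.sum_congr rfl fun i _ => ?_
      rw [mul_comm, ← smul_eq_mul, ← map_smul, ← Pi.single_smul, smul_eq_mul, mul_one]
    have h0 := h (fun i => l (Pi.single i 1)) (by
      ext x
      have : l (LinearMap.pi ψ x) = 0 := hl ⟨x, rfl⟩
      rw [hrep] at this
      simpa using this)
    ext i
    simpa using h0 i

theorem card_surjective_pi [Finite N] [Finite k] (hk : Function.Surjective (algebraMap R k))
    (e : ℕ) :
    (Nat.card {ψ : N →ₗ[R] (Fin e → k) // Function.Surjective ψ} : ℝ)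
      = ∏ i ∈ Finset.range e,
        ((Nat.card k : ℝ) ^ Module.finrank k (N →ₗ[R] k) - (Nat.card k : ℝ) ^ i) := by
  have : Finite (N →ₗ[R] k) :=
    Finite.of_injective (fun F => (F : N → k)) DFunLike.coe_injective
  have : Fintype k := Fintype.ofFinite _
  let pr : (N →ₗ[R] (Fin e → k)) → Fin e → (N →ₗ[R] k) := fun ψ i =>
    (LinearMap.proj (R := R) (φ := fun _ : Fin e => k) i) ∘ₗ ψ
  have hpr : ∀ ψ, LinearMap.pi (pr ψ) = ψ := fun _ => rfl
  have hcard : Nat.card {ψ : N →ₗ[R] (Fin e → k) // Function.Surjective ψ}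
      = Nat.card {ψ : Fin e → (N →ₗ[R] k) // LinearIndependent k ψ} :=
    Nat.card_congr
      { toFun := fun ψ => ⟨pr ψ.1, (surjective_pi_iff_linearIndependent hk (pr ψ.1)).1
          ((hpr ψ.1).symm ▸ ψ.2)⟩
        invFun := fun ψ => ⟨LinearMap.pi ψ.1, (surjective_pi_iff_linearIndependent hk ψ.1).2 ψ.2⟩
        left_inv := fun _ => rfl
        right_inv := fun _ => rfl }
  have hq : 1 < Fintype.card k := Fintype.one_lt_card
  rw [hcard, Nat.card_eq_fintype_card (α := k)]
  by_cases h : e ≤ Module.finrank k (N →ₗ[R] k)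
  · rw [card_linearIndependent h, Nat.cast_prod, Finset.prod_range]
    refine Finset.prod_congr rfl fun i _ => ?_
    rw [Nat.cast_sub (Nat.pow_le_pow_right hq.le (by omega))]
    push_cast
    rfl
  · rw [Finset.prod_eq_zero (Finset.mem_range.2 (not_le.1 h)) (sub_self _)]
    have : IsEmpty {ψ : Fin e → (N →ₗ[R] k) // LinearIndependent k ψ} := by
      refine ⟨fun ψ => h ?_⟩
      simpa using ψ.2.fintype_card_le_finrank
    simp

theorem finrank_hom_eq_zero_iff [Finite N] [Finite k] (hk : Function.Surjective (algebraMap R k))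
    {f : R} (hf : RingHom.ker (algebraMap R k) = Ideal.span {f}) :
    Module.finrank k (N →ₗ[R] k) = 0 ↔ ∀ x : N, ∃ y, f • y = x := by
  have : Finite (N →ₗ[R] k) :=
    Finite.of_injective (fun F => (F : N → k)) DFunLike.coe_injective
  rw [Module.finrank_zero_iff]
  constructor
  · intro h
    by_contra! hne
    obtain ⟨x, hx⟩ := hne
    set I : Ideal R := RingHom.ker (algebraMap R k) with hI
    let e : (R ⧸ I) ≃+* k := RingHom.quotientKerEquivOfSurjective hk
    have he : ∀ r, e.symm (algebraMap R k r) = Ideal.Quotient.mk I r := fun r => by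
      rw [RingEquiv.symm_apply_eq]; rfl
    let Q := N ⧸ I • (⊤ : Submodule R N)
    let : Module k Q := Module.compHom Q (e.symm : k →+* R ⧸ I)
    have hsmul : ∀ (r : R) (n : N), (I • (⊤ : Submodule R N)).mkQ (r • n)
        = (algebraMap R k r) • (show Q from (I • (⊤ : Submodule R N)).mkQ n) := by
      intro r n
      change _ = e.symm (algebraMap R k r) • ((I • (⊤ : Submodule R N)).mkQ n)
      rw [he]
      rfl
    have hv : (show Q from (I • (⊤ : Submodule R N)).mkQ x) ≠ 0 := by
      intro h0
      have hmem : x ∈ I • (⊤ : Submodule R N) := (Submodule.Quotient.mk_eq_zero _).1 h0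
      rw [hf, Submodule.ideal_span_singleton_smul] at hmem
      obtain ⟨y, -, hy⟩ := hmem
      exact hx y hy
    obtain ⟨l, hl⟩ := Module.Projective.exists_dual_ne_zero k hv
    let l' : N →ₗ[R] k :=
      { toFun := fun n => l ((I • (⊤ : Submodule R N)).mkQ n)
        map_add' := fun a b => by rw [map_add]; exact map_add l _ _
        map_smul' := fun r n => by
          rw [hsmul, map_smul, RingHom.id_apply, algebraMap_smul] }
    exact hl (LinearMap.congr_fun (Subsingleton.elim l' 0) x)
  · intro h
    refine ⟨fun a b => ?_⟩
    suffices h0 : ∀ a : N →ₗ[R] k, a = 0 by rw [h0 a, h0 b]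
    intro a
    ext x
    obtain ⟨y, rfl⟩ := h x
    have : algebraMap R k f = 0 := by
      rw [← RingHom.mem_ker, hf]; exact Ideal.mem_span_singleton_self f
    rw [map_smul, Algebra.smul_def, this, zero_mul, LinearMap.zero_apply]

end ResidueField

section PairCount

variable {K : Type*} [Field K]

/-- Multiplication by the variable on a `K[X]`-module, as a `K`-linear map. -/
noncomputable abbrev mulX (K M : Type*) [Field K] [AddCommGroup M] [Module K M] [Module K[X] M]
    [IsScalarTower K K[X] M] : M →ₗ[K] M :=
  Algebra.lsmul K K M (X : K[X])

section

variable {M N : Type*} [AddCommGroup M] [Module K M] [Module K[X] M] [IsScalarTower K K[X] M]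
  [AddCommGroup N] [Module K N] [Module K[X] N] [IsScalarTower K K[X] N]

theorem map_smul_of_map_X_smul (φ : M →ₗ[K] N) (h : ∀ x, φ ((X : K[X]) • x) = (X : K[X]) • φ x)
    (r : K[X]) (x : M) : φ (r • x) = r • φ x := by
  induction r using Polynomial.induction_on' with
  | add p q hp hq => rw [add_smul, map_add, hp, hq, add_smul]
  | monomial n c =>
    have hpow : ∀ (n : ℕ) (x : M), φ ((X : K[X]) ^ n • x) = (X : K[X]) ^ n • φ x := by
      intro n
      induction n with
      | zero => simp
      | succ n ih => intro x; rw [pow_succ, mul_smul, ih, h, mul_smul]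
    rw [← C_mul_X_pow_eq_monomial, mul_smul, mul_smul, ← hpow, ← Polynomial.algebraMap_eq,
      algebraMap_smul, algebraMap_smul, map_smul]

/-- A `K`-linear map that commutes with the variable is `K[X]`-linear. -/
noncomputable def LinearMap.ofMapXSMul (φ : M →ₗ[K] N) (h : ∀ x, φ ((X : K[X]) • x) = (X : K[X]) • φ x) :
    M →ₗ[K[X]] N :=
  { φ with map_smul' := map_smul_of_map_X_smul φ h }

end

/-- Pairs of a surjective map `φ : M → G` and a surjective map `ker φ → V`. -/
def SurjPair (R M G V : Type*) [CommRing R] [AddCommGroup M] [Module R M] [AddCommGroup G]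
    [Module R G] [AddCommGroup V] [Module R V] : Type _ :=
  Σ φ : {φ : M →ₗ[R] G // Function.Surjective φ},
    {ψ : LinearMap.ker φ.1 →ₗ[R] V // Function.Surjective ψ}

variable {M G V : Type*} [AddCommGroup M] [Module K M] [Module K[X] M] [IsScalarTower K K[X] M]
  [AddCommGroup G] [Module K G] [Module K[X] G] [IsScalarTower K K[X] G]
  [AddCommGroup V] [Module K V] [Module K[X] V] [IsScalarTower K K[X] V]

/-- The operator `(g, v) ↦ (X • g, B g + X • v)` on `G × V`. -/
noncomputable def extensionEnd (B : G →ₗ[K] V) : G × V →ₗ[K] G × V :=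
  LinearMap.prod (mulX K G ∘ₗ LinearMap.fst K G V)
    (B ∘ₗ LinearMap.fst K G V + mulX K V ∘ₗ LinearMap.snd K G V)

theorem extensionEnd_apply (B : G →ₗ[K] V) (x : G × V) :
    extensionEnd B x = ((X : K[X]) • x.1, B x.1 + (X : K[X]) • x.2) := rfl

theorem exists_section (φ : M →ₗ[K[X]] G) (hφ : Function.Surjective φ) :
    ∃ s : G →ₗ[K] M, ∀ g, φ (s g) = g := by
  obtain ⟨s, hs⟩ := LinearMap.exists_rightInverse_of_surjective (φ.restrictScalars K)
    (LinearMap.range_eq_top.2 hφ)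
  exact ⟨s, fun g => LinearMap.congr_fun hs g⟩

/-- The `K`-linear projection to the kernel given by a `K`-linear section. -/
noncomputable def projKer (φ : M →ₗ[K[X]] G) (s : G →ₗ[K] M) (hs : ∀ g, φ (s g) = g) :
    M →ₗ[K] LinearMap.ker φ where
  toFun x := ⟨x - s (φ x), by simp [hs]⟩
  map_add' x y := by ext; simp; abel
  map_smul' c x := by
    ext
    have : φ (c • x) = c • φ x := (φ.restrictScalars K).map_smul c x
    simp [this, smul_sub]

theorem projKer_ker (φ : M →ₗ[K[X]] G) (s : G →ₗ[K] M) (hs : ∀ g, φ (s g) = g)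
    (y : LinearMap.ker φ) : projKer φ s hs y = y := by
  ext
  simp [projKer, LinearMap.mem_ker.1 y.2]

/-- Pairs of surjections correspond to surjective intertwiners into extensions, up to the choice
of a `K`-linear extension of the second map. -/
theorem card_surjPair_mul :
    Nat.card (SurjPair K[X] M G V × (G →ₗ[K] V))
      = Nat.card (Σ B : G →ₗ[K] V, SurjIntertwiner (mulX K M) (extensionEnd B)) := by
  choose s hs using fun φ : {φ : M →ₗ[K[X]] G // Function.Surjective φ} => exists_section φ.1 φ.2
  let ext : ∀ φ : {φ : M →ₗ[K[X]] G // Function.Surjective φ},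
      (LinearMap.ker φ.1 →ₗ[K[X]] V) → (G →ₗ[K] V) → (M →ₗ[K] V) := fun φ ψ c =>
    ψ.restrictScalars K ∘ₗ projKer φ.1 (s φ) (hs φ) + c ∘ₗ φ.1.restrictScalars K
  have ext_ker : ∀ φ ψ c (y : LinearMap.ker φ.1), ext φ ψ c y = ψ y := by
    intro φ ψ c y
    simp [ext, projKer_ker, LinearMap.mem_ker.1 y.2]
  have ext_sec : ∀ φ ψ c g, ext φ ψ c (s φ g) = c g := by
    intro φ ψ c g
    have : projKer φ.1 (s φ) (hs φ) (s φ g) = 0 := by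
      ext
      simp [projKer, hs]
    simp [ext, this, hs]
  let D : (M →ₗ[K] V) → (M →ₗ[K] V) := fun t => t ∘ₗ mulX K M - mulX K V ∘ₗ t
  have D_apply : ∀ t x, D t x = t ((X : K[X]) • x) - (X : K[X]) • t x := fun _ _ => rfl
  have hD : ∀ φ ψ c x, D (ext φ ψ c) x = D (ext φ ψ c) (s φ (φ.1 x)) := by
    intro φ ψ c x
    have h1 : ∀ y : LinearMap.ker φ.1, D (ext φ ψ c) y = 0 := by
      intro y
      rw [D_apply, ← Submodule.coe_smul, ext_ker, ext_ker, map_smul, sub_self]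
    have h2 := h1 (projKer φ.1 (s φ) (hs φ) x)
    rwa [show ((projKer φ.1 (s φ) (hs φ) x : LinearMap.ker φ.1) : M) = x - s φ (φ.1 x) from rfl,
      map_sub, sub_eq_zero] at h2
  let f : SurjPair K[X] M G V × (G →ₗ[K] V) →
      Σ B : G →ₗ[K] V, SurjIntertwiner (mulX K M) (extensionEnd B) := fun P =>
    ⟨D (ext P.1.1 P.1.2.1 P.2) ∘ₗ s P.1.1,
      ⟨LinearMap.prod (P.1.1.1.restrictScalars K) (ext P.1.1 P.1.2.1 P.2), by
        rintro ⟨g, v⟩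
        obtain ⟨y, hy⟩ := P.1.2.2 (v - P.2 g)
        refine ⟨s P.1.1 g + y, Prod.ext ?_ ?_⟩
        · simp [hs, LinearMap.mem_ker.1 y.2]
        · simp [ext_sec, ext_ker, hy], by
        intro x
        refine Prod.ext (P.1.1.1.map_smul _ _) ?_
        rw [extensionEnd_apply]
        change ext _ _ _ ((X : K[X]) • x) = D (ext _ _ _) (s _ (P.1.1.1 x)) + (X : K[X]) • ext _ _ _ x
        rw [← hD, D_apply, sub_add_cancel]⟩⟩
  refine Nat.card_eq_of_bijective f ⟨?_, ?_⟩
  · rintro ⟨⟨φ, ψ⟩, c⟩ ⟨⟨φ', ψ'⟩, c'⟩ h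
    have h1 : ∀ x, (φ.1 x, ext φ ψ.1 c x) = (φ'.1 x, ext φ' ψ'.1 c' x) := fun x =>
      congrArg (fun q : Σ B : G →ₗ[K] V, SurjIntertwiner (mulX K M) (extensionEnd B) => q.2.1 x) h
    obtain rfl : φ = φ' := Subtype.ext (LinearMap.ext fun x => congrArg Prod.fst (h1 x))
    have h2 : ∀ x, ext φ ψ.1 c x = ext φ ψ'.1 c' x := fun x => congrArg Prod.snd (h1 x)
    obtain rfl : ψ = ψ' := by
      refine Subtype.ext (LinearMap.ext fun y => ?_)
      have := h2 y
      rwa [ext_ker, ext_ker] at this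
    obtain rfl : c = c' := by
      refine LinearMap.ext fun g => ?_
      have := h2 (s φ g)
      rwa [ext_sec, ext_sec] at this
    rfl
  · rintro ⟨B, F, hF, hX⟩
    have hX1 : ∀ x, (F ((X : K[X]) • x)).1 = (X : K[X]) • (F x).1 := fun x =>
      congrArg Prod.fst (hX x)
    have hX2 : ∀ x, (F ((X : K[X]) • x)).2 = B (F x).1 + (X : K[X]) • (F x).2 := fun x =>
      congrArg Prod.snd (hX x)
    let φ : {φ : M →ₗ[K[X]] G // Function.Surjective φ} :=
      ⟨LinearMap.ofMapXSMul (LinearMap.fst K G V ∘ₗ F) hX1, fun g => by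
        obtain ⟨x, hx⟩ := hF (g, 0)
        exact ⟨x, congrArg Prod.fst hx⟩⟩
    have hφ : ∀ x, φ.1 x = (F x).1 := fun _ => rfl
    let ψ : {ψ : LinearMap.ker φ.1 →ₗ[K[X]] V // Function.Surjective ψ} :=
      ⟨LinearMap.ofMapXSMul
        (LinearMap.snd K G V ∘ₗ F ∘ₗ (LinearMap.ker φ.1).subtype.restrictScalars K) (fun y => by
          have hy : (F y).1 = 0 := y.2
          have := hX2 y
          rw [hy, map_zero, zero_add] at this
          exact this), fun v => by
        obtain ⟨x, hx⟩ := hF (0, v)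
        exact ⟨⟨x, congrArg Prod.fst hx⟩, congrArg Prod.snd hx⟩⟩
    have hψ : ∀ y : LinearMap.ker φ.1, ψ.1 y = (F y).2 := fun _ => rfl
    let c : G →ₗ[K] V := LinearMap.snd K G V ∘ₗ F ∘ₗ s φ
    have hext : ∀ x, ext φ ψ.1 c x = (F x).2 := by
      intro x
      have h1 : ext φ ψ.1 c x = ψ.1 (projKer φ.1 (s φ) (hs φ) x) + c (φ.1 x) := rfl
      rw [h1, hψ]
      change (F (x - s φ (φ.1 x))).2 + (F (s φ (φ.1 x))).2 = _
      rw [← Prod.snd_add, ← map_add, sub_add_cancel]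
    refine ⟨⟨⟨φ, ψ⟩, c⟩, ?_⟩
    have key : ∀ (a b : Σ B : G →ₗ[K] V, SurjIntertwiner (mulX K M) (extensionEnd B)),
        a.1 = b.1 → (∀ x, a.2.1 x = b.2.1 x) → a = b := by
      rintro ⟨a, a'⟩ ⟨b, b'⟩ h1 h2
      obtain rfl : a = b := h1
      obtain rfl : a' = b' := Subtype.ext (LinearMap.ext h2)
      rfl
    refine key _ _ (LinearMap.ext fun g => ?_) fun x => Prod.ext (hφ x) (hext x)
    change D (ext φ ψ.1 c) (s φ g) = B g
    rw [D_apply, hext, hext, hX2, ← hφ, hs, add_sub_cancel_right]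

end PairCount

instance {R M G V : Type*} [CommRing R] [AddCommGroup M] [Module R M] [AddCommGroup G]
    [Module R G] [AddCommGroup V] [Module R V] [Finite M] [Finite G] [Finite V] :
    Finite (SurjPair R M G V) := by
  have : Finite (M →ₗ[R] G) := Finite.of_injective (fun F => (F : M → G)) DFunLike.coe_injective
  have : ∀ φ : M →ₗ[R] G, Finite (LinearMap.ker φ →ₗ[R] V) := fun φ =>
    Finite.of_injective (fun F => (F : LinearMap.ker φ → V)) DFunLike.coe_injective
  unfold SurjPair
  infer_instance

section PrimaryDecomposition

variable {K M : Type*} [Field K] [AddCommGroup M] [Module K M]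

theorem map_aeval_of_intertwine {H : Type*} [AddCommGroup H] [Module K H] {a : M →ₗ[K] M}
    {T : H →ₗ[K] H} {F : M →ₗ[K] H} (h : ∀ x, F (a x) = T (F x)) (r : K[X]) (x : M) :
    F (aeval a r x) = aeval T r (F x) := by
  induction r using Polynomial.induction_on' with
  | add p q hp hq => simp only [map_add, LinearMap.add_apply, hp, hq]
  | monomial n c =>
    have hpow : ∀ (n : ℕ) (x : M), F ((a ^ n) x) = (T ^ n) (F x) := by
      intro n
      induction n with
      | zero => simp
      | succ n ih => intro x; rw [pow_succ, pow_succ, Module.End.mul_apply, ih, h,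
          Module.End.mul_apply]
    simp [aeval_monomial, hpow]

/-- The product of a family of endomorphisms. -/
def LinearMap.piEnd {ι : Type*} {H : ι → Type*} [∀ i, AddCommGroup (H i)] [∀ i, Module K (H i)]
    (T : ∀ i, H i →ₗ[K] H i) : (∀ i, H i) →ₗ[K] ∀ i, H i :=
  LinearMap.pi fun i => T i ∘ₗ LinearMap.proj i

/-- Surjective intertwiners into operators with pairwise coprime annihilating polynomials combine
to surjective intertwiners into the product. -/
theorem card_surjIntertwiner_piEnd {ι : Type*} [Fintype ι] {H : ι → Type*}
    [∀ i, AddCommGroup (H i)] [∀ i, Module K (H i)] (a : M →ₗ[K] M) (T : ∀ i, H i →ₗ[K] H i)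
    (P : ι → K[X]) (hP : Pairwise fun i j => IsCoprime (P i) (P j))
    (hPT : ∀ i, aeval (T i) (P i) = 0) :
    Nat.card (SurjIntertwiner a (LinearMap.piEnd T)) = ∏ i, Nat.card (SurjIntertwiner a (T i)) := by
  classical
  have hu : ∀ i, ∃ u : K[X], aeval (T i) u = 1 ∧ ∀ j, j ≠ i → aeval (T j) u = 0 := by
    intro i
    obtain ⟨b, c, hbc⟩ : IsCoprime (P i) (∏ j ∈ Finset.univ.erase i, P j) :=
      IsCoprime.prod_right fun j hj => hP (Finset.ne_of_mem_erase hj).symm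
    refine ⟨c * ∏ j ∈ Finset.univ.erase i, P j, ?_, fun j hj => ?_⟩
    · rw [← eq_sub_iff_add_eq'] at hbc
      rw [hbc, map_sub, map_mul, hPT, mul_zero, sub_zero, map_one]
    · rw [← Finset.mul_prod_erase _ P (Finset.mem_erase.2 ⟨hj, Finset.mem_univ j⟩), map_mul,
        map_mul, hPT, zero_mul, mul_zero]
  choose u hu1 hu0 using hu
  rw [← Nat.card_pi]
  refine Nat.card_congr
    { toFun := fun F i => ⟨LinearMap.proj i ∘ₗ F.1, (Function.surjective_eval i).comp F.2.1,
        fun x => congrFun (F.2.2 x) i⟩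
      invFun := fun F => ⟨LinearMap.pi fun i => (F i).1, fun h => ?_, fun x =>
        funext fun i => (F i).2.2 x⟩
      left_inv := fun _ => rfl
      right_inv := fun _ => rfl }
  choose x hx using fun i => (F i).2.1 (h i)
  refine ⟨∑ i, aeval a (u i) (x i), funext fun j => ?_⟩
  rw [LinearMap.pi_apply, map_sum, Finset.sum_eq_single j]
  · rw [map_aeval_of_intertwine (F j).2.2, hu1, hx, Module.End.one_apply]
  · intro i _ hij
    rw [map_aeval_of_intertwine (F j).2.2, hu0 i j hij.symm, LinearMap.zero_apply]
  · simp

theorem aeval_mulX [Module K[X] M] [IsScalarTower K K[X] M] (r : K[X]) :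
    aeval (mulX K M) r = Algebra.lsmul K K M r := by
  rw [mulX, aeval_algHom_apply, aeval_X_left_apply]

theorem aeval_extensionEnd_eq_zero {G V : Type*}
    [AddCommGroup G] [Module K G] [Module K[X] G] [IsScalarTower K K[X] G]
    [AddCommGroup V] [Module K V] [Module K[X] V] [IsScalarTower K K[X] V] (B : G →ₗ[K] V)
    {r s : K[X]} (hr : ∀ g : G, r • g = 0) (hs : ∀ v : V, s • v = 0) :
    aeval (extensionEnd B) (s * r) = 0 := by
  have hfst : ∀ (q : K[X]) x, (aeval (extensionEnd B) q x).1 = q • x.1 := by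
    intro q x
    have := map_aeval_of_intertwine (a := extensionEnd B) (T := mulX K G)
      (F := LinearMap.fst K G V) (fun _ => rfl) q x
    rwa [aeval_mulX] at this
  have hsnd : ∀ (q : K[X]) v, aeval (extensionEnd B) q (0, v) = (0, q • v) := by
    intro q v
    have := map_aeval_of_intertwine (a := mulX K V) (T := extensionEnd B)
      (F := LinearMap.inr K G V) (fun v => by simp [extensionEnd_apply]) q v
    rw [aeval_mulX] at this
    exact this.symm
  refine LinearMap.ext fun x => ?_
  have h1 : aeval (extensionEnd B) r x = (0, (aeval (extensionEnd B) r x).2) :=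
    Prod.ext ((hfst r x).trans (hr _)) rfl
  rw [map_mul, Module.End.mul_apply, h1, hsnd, hs]
  rfl

theorem card_surjIntertwiner_aeval' {H : Type*} [AddCommGroup H] [Module K H] (a : M →ₗ[K] M)
    (T : H →ₗ[K] H) :
    Nat.card (SurjIntertwiner (mulX K (Module.AEval' a)) T) = Nat.card (SurjIntertwiner a T) :=
  Nat.card_congr
    { toFun := fun F => ⟨F.1 ∘ₗ (Module.AEval'.of a).toLinearMap,
        F.2.1.comp (Module.AEval'.of a).surjective, fun x =>
          (congrArg F.1 (Module.AEval'.X_smul_of a x)).symm.trans (F.2.2 _)⟩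
      invFun := fun F => ⟨F.1 ∘ₗ (Module.AEval'.of a).symm.toLinearMap,
        F.2.1.comp (Module.AEval'.of a).symm.surjective, fun x => by
          obtain ⟨y, rfl⟩ := (Module.AEval'.of a).surjective x
          change F.1 ((Module.AEval'.of a).symm ((X : K[X]) • Module.AEval'.of a y))
            = T (F.1 ((Module.AEval'.of a).symm (Module.AEval'.of a y)))
          rw [Module.AEval'.X_smul_of, LinearEquiv.symm_apply_apply, LinearEquiv.symm_apply_apply]
          exact F.2.2 y⟩
      left_inv := fun F => Subtype.ext (LinearMap.ext fun x => by simp)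
      right_inv := fun F => Subtype.ext (LinearMap.ext fun x => by simp) }

end PrimaryDecomposition

instance {K : Type*} [Field K] [Finite K] {n : ℕ} (a : (Fin n → K) →ₗ[K] (Fin n → K)) :
    Finite (Module.AEval' a) :=
  Finite.of_equiv _ (Module.AEval'.of a).toEquiv

section MixedMoments

variable {p : ℕ} [Fact p.Prime]

/-- The row space of a square matrix `M`, on which the variable acts by `v ↦ v ᵥ* M`. -/
abbrev rowModule {K : Type*} [Field K] {n : ℕ} (M : Matrix (Fin n) (Fin n) K) : Type _ :=
  Module.AEval' (M.vecMulLinear)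

theorem tendsto_matrixExp_prod_card_surjPair {ε : ℝ} (hε : 0 < ε)
    {w : ∀ n, Fin n → Fin n → ZMod p → ℝ} (hw : ∀ n j i, IsBalancedWeight ε (w n j i))
    {ι : Type*} [Fintype ι] (G V : ι → Type*)
    [∀ i, AddCommGroup (G i)] [∀ i, Module (ZMod p) (G i)] [∀ i, Module (ZMod p)[X] (G i)]
    [∀ i, IsScalarTower (ZMod p) (ZMod p)[X] (G i)] [∀ i, Finite (G i)]
    [∀ i, AddCommGroup (V i)] [∀ i, Module (ZMod p) (V i)] [∀ i, Module (ZMod p)[X] (V i)]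
    [∀ i, IsScalarTower (ZMod p) (ZMod p)[X] (V i)] [∀ i, Finite (V i)]
    (P Q : ι → (ZMod p)[X]) (hPQ : Pairwise fun i j => IsCoprime (Q i * P i) (Q j * P j))
    (hP : ∀ i (g : G i), P i • g = 0) (hQ : ∀ i (v : V i), Q i • v = 0) :
    Tendsto (fun n => matrixExp (w n) fun M =>
      ∏ i, (Nat.card (SurjPair (ZMod p)[X] (rowModule M) (G i) (V i)) : ℝ)) atTop (𝓝 1) := by
  classical
  have hfin : ∀ i, Finite (G i →ₗ[ZMod p] V i) := fun i =>
    Finite.of_injective (fun F => (F : G i → V i)) DFunLike.coe_injective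
  have : ∀ i, Fintype (G i →ₗ[ZMod p] V i) := fun i => Fintype.ofFinite _
  have : Fintype (∀ i, G i × V i) := Fintype.ofFinite _
  set c : ℝ := ∏ i, (Nat.card (G i →ₗ[ZMod p] V i) : ℝ) with hc
  have hc0 : c ≠ 0 := Finset.prod_ne_zero_iff.2 fun i _ => by
    exact_mod_cast Nat.card_pos.ne'
  have hM : ∀ n (M : Matrix (Fin n) (Fin n) (ZMod p)),
      ∏ i, (Nat.card (SurjPair (ZMod p)[X] (rowModule M) (G i) (V i)) : ℝ)
        = c⁻¹ * ∑ B : ∀ i, G i →ₗ[ZMod p] V i, (Nat.card (SurjIntertwiner M.vecMulLinear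
            (LinearMap.piEnd fun i => extensionEnd (B i))) : ℝ) := by
    intro n M
    rw [eq_inv_mul_iff_mul_eq₀ hc0, hc, ← Finset.prod_mul_distrib]
    have h1 : ∀ i, (Nat.card (G i →ₗ[ZMod p] V i) : ℝ)
        * Nat.card (SurjPair (ZMod p)[X] (rowModule M) (G i) (V i))
        = ∑ B : G i →ₗ[ZMod p] V i,
          (Nat.card (SurjIntertwiner M.vecMulLinear (extensionEnd B)) : ℝ) := by
      intro i
      rw [mul_comm, ← Nat.cast_mul, ← Nat.card_prod, card_surjPair_mul, Nat.card_sigma,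
        Nat.cast_sum]
      simp only [card_surjIntertwiner_aeval']
    simp only [h1]
    rw [Finset.prod_univ_sum, Fintype.piFinset_univ]
    refine Finset.sum_congr rfl fun B _ => ?_
    rw [card_surjIntertwiner_piEnd _ _ (fun i => Q i * P i) hPQ fun i =>
      aeval_extensionEnd_eq_zero (B i) (hP i) (hQ i), Nat.cast_prod]
  simp only [hM, matrixExp_const_mul, matrixExp_sum]
  have hlim : Tendsto (fun n => c⁻¹ * ∑ B : ∀ i, G i →ₗ[ZMod p] V i, matrixExp (w n) fun M =>
      (Nat.card (SurjIntertwiner M.vecMulLinear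
        (LinearMap.piEnd fun i => extensionEnd (B i))) : ℝ)) atTop
      (𝓝 (c⁻¹ * ∑ _B : ∀ i, G i →ₗ[ZMod p] V i, 1)) :=
    (tendsto_finsetSum _ fun B _ =>
      tendsto_matrixExp_card_surjIntertwiner hε hw _).const_mul _
  have h1 : c⁻¹ * ∑ _B : ∀ i, G i →ₗ[ZMod p] V i, (1 : ℝ) = 1 := by
    rw [Finset.sum_const, nsmul_eq_mul, mul_one, Finset.card_univ, Fintype.card_pi, hc]
    push_cast
    simp only [Nat.card_eq_fintype_card]
    exact inv_mul_cancel₀ (by simpa only [hc, Nat.card_eq_fintype_card] using hc0)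
  rwa [h1] at hlim

end MixedMoments

section EulerProduct

theorem summable_eulerCoeff {q : ℝ} (hq : 1 < q) : Summable (eulerCoeff q) := by
  have hne : ∀ e, eulerCoeff q e ≠ 0 := fun e =>
    Finset.prod_ne_zero_iff.2 fun i _ => inv_ne_zero (one_sub_pow_succ_ne_zero hq i)
  refine summable_of_ratio_test_tendsto_lt_one (l := 0) one_pos (Eventually.of_forall hne) ?_
  have h1 : ∀ e, ‖eulerCoeff q (e + 1)‖ / ‖eulerCoeff q e‖ = (q ^ (e + 1) - 1)⁻¹ := by
    intro e
    rw [eulerCoeff_succ, norm_mul, mul_div_cancel_left₀ _ (norm_ne_zero_iff.2 (hne e)), norm_inv,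
      Real.norm_eq_abs, abs_sub_comm, abs_of_pos (sub_pos.2 (one_lt_pow₀ hq e.succ_ne_zero))]
  simp only [h1]
  refine tendsto_inv_atTop_zero.comp (tendsto_atTop_add_const_right _ _ ?_)
  exact (tendsto_pow_atTop_atTop_of_one_lt hq).comp (tendsto_add_atTop_nat 1)

/-- Euler's identity for `∏_{j ≥ 1} (1 - q ^ (-j))`. -/
theorem hasSum_eulerCoeff {q : ℝ} (hq : 1 < q) :
    HasSum (eulerCoeff q) (∏' j : ℕ, (1 - (q ^ (j + 1))⁻¹)) := by
  have hq0 : 0 < q := one_pos.trans hq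
  set u : ℝ := q⁻¹ with hu
  have hu0 : 0 < u := inv_pos.2 hq0
  have hu1 : u < 1 := inv_lt_one_of_one_lt₀ hq
  have hsum := summable_eulerCoeff hq
  have hle : ∀ N e : ℕ, ‖eulerCoeff q e * (u ^ N) ^ e‖ ≤ ‖eulerCoeff q e‖ := by
    intro N e
    rw [norm_mul]
    refine mul_le_of_le_one_right (norm_nonneg _) ?_
    rw [Real.norm_eq_abs, abs_of_pos (by positivity)]
    exact pow_le_one₀ (by positivity) (pow_le_one₀ hu0.le hu1.le)
  have hsumN : ∀ N : ℕ, Summable fun e => eulerCoeff q e * (u ^ N) ^ e := fun N =>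
    Summable.of_norm_bounded hsum.norm (hle N)
  set F : ℕ → ℝ := fun N => ∑' e, eulerCoeff q e * (u ^ N) ^ e with hF
  have hrec : ∀ N, F N = (1 - u ^ (N + 1)) * F (N + 1) := by
    intro N
    have h1 : F N - F (N + 1)
        = ∑' e, (eulerCoeff q e * (u ^ N) ^ e - eulerCoeff q e * (u ^ (N + 1)) ^ e) :=
      ((hsumN N).tsum_sub (hsumN (N + 1))).symm
    rw [((hsumN N).sub (hsumN (N + 1))).tsum_eq_zero_add] at h1
    simp only [pow_zero, sub_self, zero_add] at h1
    have h2 : ∀ e, eulerCoeff q (e + 1) * (u ^ N) ^ (e + 1)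
        - eulerCoeff q (e + 1) * (u ^ (N + 1)) ^ (e + 1)
        = -u ^ (N + 1) * (eulerCoeff q e * (u ^ (N + 1)) ^ e) := by
      intro e
      have h3 := one_sub_pow_succ_ne_zero hq e
      have h4 : eulerCoeff q (e + 1) * (1 - u ^ (e + 1)) = -eulerCoeff q e * u ^ (e + 1) := by
        rw [eulerCoeff_succ, hu, inv_pow]
        field_simp
        ring
      have h5 : (u ^ (N + 1)) ^ (e + 1) = (u ^ N) ^ (e + 1) * u ^ (e + 1) := by ring
      calc _ = (u ^ N) ^ (e + 1) * (eulerCoeff q (e + 1) * (1 - u ^ (e + 1))) := by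
            rw [h5]; ring
        _ = _ := by rw [h4]; ring
    simp only [h2, tsum_mul_left] at h1
    have : ∑' e, eulerCoeff q e * (u ^ (N + 1)) ^ e = F (N + 1) := rfl
    rw [this] at h1
    linarith
  have hF1 : Tendsto F atTop (𝓝 1) := by
    have hlim : ∀ e : ℕ, Tendsto (fun N : ℕ => eulerCoeff q e * (u ^ N) ^ e) atTop
        (𝓝 (if e = 0 then 1 else 0)) := by
      intro e
      split_ifs with h
      · subst h; simp [eulerCoeff]
      · have := ((tendsto_pow_atTop_nhds_zero_of_lt_one hu0.le hu1).pow e).const_mul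
          (eulerCoeff q e)
        rwa [zero_pow h, mul_zero] at this
    have := tendsto_tsum_of_dominated_convergence hsum.norm hlim
      (Eventually.of_forall fun N e => hle N e)
    rwa [tsum_ite_eq] at this
  have hprod : ∀ N, F 0 = (∏ j ∈ Finset.range N, (1 - (q ^ (j + 1))⁻¹)) * F N := by
    intro N
    induction N with
    | zero => simp
    | succ N ih => rw [ih, Finset.prod_range_succ, hrec N, hu, inv_pow, mul_assoc]
  have hmult : Multipliable fun j : ℕ => 1 - (q ^ (j + 1))⁻¹ := by
    simp only [sub_eq_add_neg]
    refine multipliable_one_add_of_summable ?_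
    simp only [norm_neg]
    have : Summable fun j : ℕ => u ^ (j + 1) :=
      (summable_nat_add_iff 1).2 (summable_geometric_of_lt_one hu0.le hu1)
    simpa [hu] using this.norm
  have hconst := hmult.hasProd.tendsto_prod_nat.mul hF1
  simp only [← hprod, mul_one] at hconst
  have hF0 : F 0 = ∏' j : ℕ, (1 - (q ^ (j + 1))⁻¹) := tendsto_nhds_unique tendsto_const_nhds hconst
  rw [← hF0]
  have : F 0 = ∑' e, eulerCoeff q e := by simp [hF]
  rw [this]
  exact hsum.hasSum

end EulerProduct

section Sandwich

theorem tendsto_of_approx {x : ℕ → ℝ} {s b : ℕ → ℕ → ℝ} {S B : ℕ → ℝ} {W : ℝ}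
    (h : ∀ m n, |x n - s m n| ≤ b m n) (hs : ∀ m, Tendsto (s m) atTop (𝓝 (S m)))
    (hb : ∀ m, Tendsto (b m) atTop (𝓝 (B m))) (hS : Tendsto S atTop (𝓝 W))
    (hB : Tendsto B atTop (𝓝 0)) : Tendsto x atTop (𝓝 W) := by
  rw [Metric.tendsto_atTop]
  intro δ hδ
  have hδ4 : 0 < δ / 4 := by linarith
  obtain ⟨m, hm1, hm2⟩ := ((hS.eventually (Metric.ball_mem_nhds W hδ4)).and
    (hB.eventually (Metric.ball_mem_nhds 0 hδ4))).exists
  obtain ⟨n₀, hn₀⟩ := eventually_atTop.1 (((hs m).eventually (Metric.ball_mem_nhds _ hδ4)).and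
    ((hb m).eventually (Metric.ball_mem_nhds _ hδ4)))
  refine ⟨n₀, fun n hn => ?_⟩
  obtain ⟨h1, h2⟩ := hn₀ n hn
  have h3 := h m n
  simp only [Real.dist_eq, abs_lt] at hm1 hm2 h1 h2 ⊢
  rw [abs_le] at h3
  constructor <;> linarith [hm1.1, hm1.2, hm2.1, hm2.2, h1.1, h1.2, h2.1, h2.2, h3.1, h3.2]

variable {p : ℕ} [Fact p.Prime]

/-- Bonferroni-type inequalities turn the convergence of all mixed moments into the convergence of
the expected product of the counts that the moments approximate. -/
theorem tendsto_matrixExp_prod_of_bonferroni {w : ∀ n, Fin n → Fin n → ZMod p → ℝ}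
    (hw : ∀ n i j x, 0 ≤ w n i j x) {ι : Type*} [Fintype ι]
    (a : ι → ∀ n, Matrix (Fin n) (Fin n) (ZMod p) → ℝ)
    (Y : ι → ℕ → ∀ n, Matrix (Fin n) (Fin n) (ZMod p) → ℝ)
    (ha : ∀ i n M, 0 ≤ a i n M) (hY : ∀ i e n M, 0 ≤ Y i e n M)
    (c : ι → ℕ → ℝ) (W : ι → ℝ) (hc : ∀ i, HasSum (c i) (W i))
    (hbonf : ∀ i m n M, |a i n M - ∑ e ∈ Finset.range (m + 1), c i e * Y i e n M|
      ≤ |c i m| * Y i m n M)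
    (hlim : ∀ e : ι → ℕ, Tendsto (fun n => matrixExp (w n) fun M => ∏ i, Y i (e i) n M) atTop
      (𝓝 1)) :
    Tendsto (fun n => matrixExp (w n) fun M => ∏ i, a i n M) atTop (𝓝 (∏ i, W i)) := by
  classical
  suffices H : ∀ (s : Finset ι) (e : ι → ℕ), Tendsto (fun n => matrixExp (w n) fun M =>
      ∏ i, if i ∈ s then a i n M else Y i (e i) n M) atTop (𝓝 (∏ i ∈ s, W i)) by
    simpa using H Finset.univ 0
  intro s
  induction s using Finset.induction_on with
  | empty => simpa using hlim
  | insert j s hj ih =>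
    intro e
    set Z : ∀ n, Matrix (Fin n) (Fin n) (ZMod p) → ℝ := fun n M =>
      ∏ i ∈ Finset.univ.erase j, if i ∈ s then a i n M else Y i (e i) n M with hZ
    have hZ0 : ∀ n M, 0 ≤ Z n M := fun n M => Finset.prod_nonneg fun i _ => by
      split_ifs
      exacts [ha i n M, hY i _ n M]
    have e1 : ∀ n M, (∏ i, if i ∈ insert j s then a i n M else Y i (e i) n M)
        = a j n M * Z n M := by
      intro n M
      rw [← Finset.mul_prod_erase _ _ (Finset.mem_univ j), if_pos (Finset.mem_insert_self j s)]
      congr 1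
      refine Finset.prod_congr rfl fun i hi => ?_
      simp only [Finset.mem_insert, Finset.ne_of_mem_erase hi, false_or]
    have e2 : ∀ k n M, (∏ i, if i ∈ s then a i n M else Y i (Function.update e j k i) n M)
        = Y j k n M * Z n M := by
      intro k n M
      rw [← Finset.mul_prod_erase _ _ (Finset.mem_univ j), if_neg hj, Function.update_self]
      congr 1
      refine Finset.prod_congr rfl fun i hi => ?_
      rw [Function.update_of_ne (Finset.ne_of_mem_erase hi)]
    have ih' : ∀ k, Tendsto (fun n => matrixExp (w n) fun M => Y j k n M * Z n M) atTop
        (𝓝 (∏ i ∈ s, W i)) := fun k => by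
      simpa only [e2] using ih (Function.update e j k)
    simp only [e1]
    rw [Finset.prod_insert hj]
    refine tendsto_of_approx
      (s := fun m n => ∑ k ∈ Finset.range (m + 1), c j k * matrixExp (w n) fun M =>
        Y j k n M * Z n M)
      (b := fun m n => |c j m| * matrixExp (w n) fun M => Y j m n M * Z n M)
      (S := fun m => ∑ k ∈ Finset.range (m + 1), c j k * ∏ i ∈ s, W i)
      (B := fun m => |c j m| * ∏ i ∈ s, W i) (fun m n => ?_)
      (fun m => tendsto_finsetSum _ fun k _ => (ih' k).const_mul _)
      (fun m => (ih' m).const_mul _) ?_ ?_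
    · simp only [← matrixExp_const_mul, ← matrixExp_sum]
      refine abs_matrixExp_sub_le (hw n) fun M => ?_
      calc _ = |a j n M - ∑ k ∈ Finset.range (m + 1), c j k * Y j k n M| * Z n M := by
            rw [← abs_of_nonneg (hZ0 n M), ← abs_mul, abs_of_nonneg (hZ0 n M), sub_mul,
              Finset.sum_mul]
            simp only [mul_assoc]
        _ ≤ |c j m| * Y j m n M * Z n M := mul_le_mul_of_nonneg_right (hbonf j m n M) (hZ0 n M)
        _ = _ := mul_assoc _ _ _
    · simp only [← Finset.sum_mul]
      exact (((tendsto_add_atTop_iff_nat 1).2 (hc j).tendsto_sum_nat)).mul_const _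
    · have := ((hc j).summable.tendsto_atTop_zero.abs).mul_const (∏ i ∈ s, W i)
      simpa using this

end Sandwich

section GoodSurjections

/-- Surjective maps on whose kernel `f` acts surjectively. -/
def GoodSurj {R : Type*} [CommRing R] (f : R) (M G : Type*) [AddCommGroup M] [Module R M]
    [AddCommGroup G] [Module R G] : Type _ :=
  {φ : M →ₗ[R] G // Function.Surjective φ ∧ ∀ x : LinearMap.ker φ, ∃ y, f • y = x}

variable {R M G : Type*} [CommRing R] [AddCommGroup M] [Module R M] [AddCommGroup G] [Module R G]

theorem abs_card_goodSurj_sub_le {k : Type*} [Field k] [Algebra R k] [Finite k] [Finite M]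
    [Finite G] (hk : Function.Surjective (algebraMap R k)) {f : R}
    (hf : RingHom.ker (algebraMap R k) = Ideal.span {f}) (m : ℕ) :
    |(Nat.card (GoodSurj f M G) : ℝ) - ∑ e ∈ Finset.range (m + 1),
        eulerCoeff (Nat.card k) e * (Nat.card (SurjPair R M G (Fin e → k)) : ℝ)|
      ≤ |eulerCoeff (Nat.card k) m| * (Nat.card (SurjPair R M G (Fin m → k)) : ℝ) := by
  classical
  have hq : (1 : ℝ) < Nat.card k := by exact_mod_cast Finite.one_lt_card
  have : Finite (M →ₗ[R] G) := Finite.of_injective (fun F => (F : M → G)) DFunLike.coe_injective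
  have : Fintype {φ : M →ₗ[R] G // Function.Surjective φ} := Fintype.ofFinite _
  let d : {φ : M →ₗ[R] G // Function.Surjective φ} → ℕ := fun φ =>
    Module.finrank k (LinearMap.ker φ.1 →ₗ[R] k)
  have hpair : ∀ e, (Nat.card (SurjPair R M G (Fin e → k)) : ℝ)
      = ∑ φ, ∏ i ∈ Finset.range e, ((Nat.card k : ℝ) ^ d φ - (Nat.card k : ℝ) ^ i) := by
    intro e
    have : ∀ φ : {φ : M →ₗ[R] G // Function.Surjective φ},
        Finite (LinearMap.ker φ.1 →ₗ[R] (Fin e → k)) := fun φ =>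
      Finite.of_injective (fun F => (F : LinearMap.ker φ.1 → Fin e → k)) DFunLike.coe_injective
    rw [SurjPair, Nat.card_sigma, Nat.cast_sum]
    exact Finset.sum_congr rfl fun φ _ => card_surjective_pi hk e
  have hgood : (Nat.card (GoodSurj f M G) : ℝ) = ∑ φ, if d φ = 0 then (1 : ℝ) else 0 := by
    rw [Finset.sum_boole, ← Fintype.card_subtype, ← Nat.card_eq_fintype_card]
    congr 1
    refine Nat.card_congr ((Equiv.subtypeSubtypeEquivSubtypeInter _ _).symm.trans
      (Equiv.subtypeEquivRight fun φ => ?_))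
    exact (finrank_hom_eq_zero_iff hk hf).symm
  rw [hgood]
  simp only [hpair, Finset.mul_sum]
  rw [Finset.sum_comm, ← Finset.sum_sub_distrib]
  refine (Finset.abs_sum_le_sum_abs _ _).trans (Finset.sum_le_sum fun φ _ => ?_)
  exact abs_indicator_sub_sum_eulerCoeff_le hq (d φ) m

theorem GoodSurj.mem_ker_iff {f : R} {N : ℕ} (hN : ∀ g : G, f ^ N • g = 0) (φ : GoodSurj f M G)
    (x : M) : φ.1 x = 0 ↔ ∃ y, f ^ N • y = x := by
  constructor
  · intro hx
    have hpow : ∀ (n : ℕ) (x : LinearMap.ker φ.1), ∃ y, f ^ n • y = x := by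
      intro n
      induction n with
      | zero => exact fun x => ⟨x, by simp⟩
      | succ n ih =>
        intro x
        obtain ⟨y, rfl⟩ := φ.2.2 x
        obtain ⟨z, rfl⟩ := ih y
        exact ⟨z, by rw [pow_succ', mul_smul]⟩
    obtain ⟨y, hy⟩ := hpow N ⟨x, hx⟩
    exact ⟨y, congrArg Subtype.val hy⟩
  · rintro ⟨y, rfl⟩
    rw [map_smul, hN]

theorem GoodSurj.exists_equiv {G' : Type*} [AddCommGroup G'] [Module R G'] {f : R} {N : ℕ}
    (hN : ∀ g : G, f ^ N • g = 0) (hN' : ∀ g : G', f ^ N • g = 0) (φ : GoodSurj f M G)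
    (φ' : GoodSurj f M G') : ∃ α : G ≃ₗ[R] G', ∀ x, α (φ.1 x) = φ'.1 x := by
  have hker : LinearMap.ker φ.1 = LinearMap.ker φ'.1 := by
    ext x
    rw [LinearMap.mem_ker, LinearMap.mem_ker, φ.mem_ker_iff hN, φ'.mem_ker_iff hN']
  refine ⟨(φ.1.quotKerEquivOfSurjective φ.2.1).symm ≪≫ₗ Submodule.quotEquivOfEq _ _ hker ≪≫ₗ
    φ'.1.quotKerEquivOfSurjective φ'.2.1, fun x => ?_⟩
  have : (φ.1.quotKerEquivOfSurjective φ.2.1).symm (φ.1 x) = Submodule.Quotient.mk x := by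
    rw [LinearEquiv.symm_apply_eq]; rfl
  simp [this]

theorem GoodSurj.card_eq {f : R} {N : ℕ} (hN : ∀ g : G, f ^ N • g = 0) (φ : GoodSurj f M G) :
    Nat.card (GoodSurj f M G) = Nat.card (G ≃ₗ[R] G) := by
  symm
  have hker : ∀ α : G ≃ₗ[R] G, LinearMap.ker (α.toLinearMap ∘ₗ φ.1) = LinearMap.ker φ.1 :=
    fun α => by ext x; simp
  refine Nat.card_eq_of_bijective (fun α : G ≃ₗ[R] G => (⟨α.toLinearMap ∘ₗ φ.1,
    α.surjective.comp φ.2.1, by rw [hker]; exact φ.2.2⟩ : GoodSurj f M G)) ⟨?_, ?_⟩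
  · intro α β h
    refine LinearEquiv.ext fun g => ?_
    obtain ⟨x, rfl⟩ := φ.2.1 g
    exact LinearMap.congr_fun (congrArg Subtype.val h) x
  · intro φ'
    obtain ⟨α, hα⟩ := φ.exists_equiv hN hN φ'
    exact ⟨α, Subtype.ext (LinearMap.ext hα)⟩

end GoodSurjections

section CompanionBasis

variable {K : Type*} [Field K]

/-- The basis `1, X, X ^ 2, …` of `K[X] / (g)`. -/
noncomputable def quotientBasis {g : K[X]} (hg : g.Monic) :
    Module.Basis (Fin g.natDegree) K (K[X] ⧸ Ideal.span {g}) :=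
  AdjoinRoot.powerBasisAux' hg

theorem quotientBasis_apply {g : K[X]} (hg : g.Monic) (i : Fin g.natDegree) :
    quotientBasis hg i = Ideal.Quotient.mk (Ideal.span {g}) (X ^ (i : ℕ)) := by
  have := (AdjoinRoot.powerBasis' hg).basis_eq_pow i
  rw [AdjoinRoot.powerBasis'_gen] at this
  rw [map_pow]
  exact this

theorem X_smul_quotientBasis {g : K[X]} (hg : g.Monic) (i : Fin g.natDegree) :
    (X : K[X]) • quotientBasis hg i = ∑ j, companionMatrix g i j • quotientBasis hg j := by
  have hmk : ∀ r : K[X], (X : K[X]) • Ideal.Quotient.mk (Ideal.span {g}) r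
      = Ideal.Quotient.mk (Ideal.span {g}) (X * r) := fun _ => rfl
  rw [quotientBasis_apply, hmk, ← pow_succ']
  by_cases h : (i : ℕ) + 1 = g.natDegree
  · have hcomp : ∀ j, companionMatrix g i j = -g.coeff j := fun j => by
      simp [companionMatrix, h]
    have hsmul : ∀ j : Fin g.natDegree, companionMatrix g i j • quotientBasis hg j
        = Ideal.Quotient.mk (Ideal.span {g}) (-(C (g.coeff j) * X ^ (j : ℕ))) := by
      intro j
      rw [hcomp, quotientBasis_apply, neg_smul, map_neg, ← smul_eq_C_mul]
      rfl
    simp only [hsmul]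
    rw [← map_sum, Ideal.Quotient.mk_eq_mk_iff_sub_mem, Finset.sum_neg_distrib, sub_neg_eq_add, h,
      Ideal.mem_span_singleton]
    conv_rhs => rw [← Finset.sum_range (fun j => C (g.coeff j) * X ^ j)]
    rw [← hg.as_sum]
  · have hlt : (i : ℕ) + 1 < g.natDegree := by omega
    rw [Finset.sum_eq_single ⟨i + 1, hlt⟩]
    · simp [companionMatrix, h, quotientBasis_apply]
    · intro j _ hj
      have : (j : ℕ) ≠ i + 1 := fun h' => hj (Fin.ext h')
      simp [companionMatrix, h, this]
    · simp

variable {B : Type*} (g : B → K[X]) (hg : ∀ b, (g b).Monic)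

/-- The basis of `⨁_b K[X] / (g_b)` that consists of the powers of `X` in all the summands. -/
noncomputable def sumQuotientBasis :
    Module.Basis (Σ b, Fin (g b).natDegree) K (⨁ b, K[X] ⧸ Ideal.span {g b}) :=
  DFinsupp.basis fun b => quotientBasis (hg b)

open Classical in
theorem sumQuotientBasis_apply (b : B) (i : Fin (g b).natDegree) :
    sumQuotientBasis g hg ⟨b, i⟩
      = DirectSum.lof K[X] B (fun b => K[X] ⧸ Ideal.span {g b}) b (quotientBasis (hg b) i) := by
  rw [sumQuotientBasis, Module.Basis.apply_eq_iff, DFinsupp.basis]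
  change (sigmaFinsuppLequivDFinsupp K).symm (DFinsupp.mapRange.linearEquiv
    (fun b => (quotientBasis (hg b)).repr) (DFinsupp.single b (quotientBasis (hg b) i))) = _
  rw [LinearEquiv.symm_apply_eq]
  simp

open Classical in
theorem X_smul_sumQuotientBasis (b : B) (i : Fin (g b).natDegree) :
    (X : K[X]) • sumQuotientBasis g hg ⟨b, i⟩
      = ∑ j, companionMatrix (g b) i j • sumQuotientBasis g hg ⟨b, j⟩ := by
  simp only [sumQuotientBasis_apply]
  rw [← map_smul, X_smul_quotientBasis, map_sum]
  refine Finset.sum_congr rfl fun j _ => ?_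
  exact ((DirectSum.lof K[X] B (fun b => K[X] ⧸ Ideal.span {g b}) b).restrictScalars K).map_smul
    (companionMatrix (g b) i j) (quotientBasis (hg b) j)

theorem X_smul_sumQuotientBasis_reindex [DecidableEq B] {n : ℕ} (e : (Σ b, Fin (g b).natDegree) ≃ Fin n)
    (i : Fin n) :
    (X : K[X]) • (sumQuotientBasis g hg).reindex e i
      = ∑ j, Matrix.reindex e e (Matrix.blockDiagonal' fun b => companionMatrix (g b)) i j •
          (sumQuotientBasis g hg).reindex e j := by
  classical
  obtain ⟨⟨b, s⟩, rfl⟩ := e.surjective i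
  have : Fintype (Σ b, Fin (g b).natDegree) := Fintype.ofEquiv _ e.symm
  rw [← e.sum_comp]
  simp only [Module.Basis.reindex_apply, Equiv.symm_apply_apply, Matrix.reindex_apply,
    Matrix.submatrix_apply]
  rw [X_smul_sumQuotientBasis]
  have hinj : Function.Injective fun j : Fin (g b).natDegree =>
      (⟨b, j⟩ : Σ b, Fin (g b).natDegree) :=
    sigma_mk_injective (β := fun b => Fin (g b).natDegree)
  rw [← Finset.sum_subset (Finset.subset_univ (Finset.univ.map ⟨_, hinj⟩)), Finset.sum_map]
  · simp only [Function.Embedding.coeFn_mk, Matrix.blockDiagonal'_apply_eq]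
  · rintro ⟨b', t⟩ _ ht
    rw [Matrix.blockDiagonal'_apply_ne, zero_smul]
    rintro rfl
    exact ht (Finset.mem_map.2 ⟨t, Finset.mem_univ t, rfl⟩)

end CompanionBasis

section Conjugacy

variable {K : Type*} [Field K] {n : ℕ} {D : Type*} [AddCommGroup D] [Module K D] [Module K[X] D]
  [IsScalarTower K K[X] D] (b : Module.Basis (Fin n) K D) (A C : Matrix (Fin n) (Fin n) K)

theorem conj_iff_nonempty_equiv (hC : ∀ i, (X : K[X]) • b i = ∑ j, C i j • b j) :
    (∃ P : GL (Fin n) K, (P⁻¹).val * A * P.val = C) ↔ Nonempty (rowModule A ≃ₗ[K[X]] D) := by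
  constructor
  · rintro ⟨P, hP⟩
    have hAP : A * P.val = P.val * C := by
      rw [← hP, mul_assoc, ← mul_assoc P.val, Units.mul_inv, one_mul]
    let φ : rowModule A →ₗ[K] D := b.equivFun.symm.toLinearMap ∘ₗ P.val.vecMulLinear ∘ₗ
      (Module.AEval'.of A.vecMulLinear).symm.toLinearMap
    have hφ : ∀ v, φ (Module.AEval'.of A.vecMulLinear v) = ∑ i, (Matrix.vecMul v P.val) i • b i := by
      intro v
      simp [φ, Module.Basis.equivFun_symm_apply]
    have hX : ∀ x, φ ((X : K[X]) • x) = (X : K[X]) • φ x := by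
      intro x
      obtain ⟨v, rfl⟩ := (Module.AEval'.of A.vecMulLinear).surjective x
      rw [Module.AEval'.X_smul_of, hφ, hφ, Finset.smul_sum, Matrix.vecMulLinear_apply,
        Matrix.vecMul_vecMul, hAP, ← Matrix.vecMul_vecMul]
      have : ∀ i, (X : K[X]) • (Matrix.vecMul v P.val) i • b i
          = ∑ j, ((Matrix.vecMul v P.val) i * C i j) • b j := by
        intro i
        rw [smul_comm, hC, Finset.smul_sum]
        simp only [smul_smul]
      simp only [this]
      rw [Finset.sum_comm]
      refine Finset.sum_congr rfl fun j _ => ?_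
      rw [← Finset.sum_smul]
      rfl
    have hbij : Function.Bijective φ := by
      refine b.equivFun.symm.bijective.comp (Function.Bijective.comp (g := P.val.vecMulLinear) ?_
        (Module.AEval'.of A.vecMulLinear).symm.bijective)
      refine Function.bijective_iff_has_inverse.2 ⟨(P⁻¹).val.vecMulLinear, fun v => ?_, fun v => ?_⟩
      · rw [Matrix.vecMulLinear_apply, Matrix.vecMulLinear_apply, Matrix.vecMul_vecMul,
          Units.mul_inv, Matrix.vecMul_one]
      · rw [Matrix.vecMulLinear_apply, Matrix.vecMulLinear_apply, Matrix.vecMul_vecMul,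
          Units.inv_mul, Matrix.vecMul_one]
    exact ⟨LinearEquiv.ofBijective (LinearMap.ofMapXSMul φ hX) hbij⟩
  · rintro ⟨Φ⟩
    let θ : D →ₗ[K] (Fin n → K) := (Module.AEval'.of A.vecMulLinear).symm.toLinearMap ∘ₗ
      Φ.symm.toLinearMap.restrictScalars K
    have hθ : Function.Injective θ :=
      (Module.AEval'.of A.vecMulLinear).symm.injective.comp Φ.symm.injective
    have hθX : ∀ d, θ ((X : K[X]) • d) = Matrix.vecMul (θ d) A := by
      intro d
      change (Module.AEval'.of A.vecMulLinear).symm (Φ.symm ((X : K[X]) • d)) = _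
      rw [map_smul, LinearEquiv.symm_apply_eq, ← Matrix.vecMulLinear_apply, ← Module.AEval'.X_smul_of]
      congr 1
    let Q : Matrix (Fin n) (Fin n) K := Matrix.of fun i => θ (b i)
    have hQ : IsUnit Q := by
      rw [← Matrix.linearIndependent_rows_iff_isUnit]
      exact b.linearIndependent.map' θ (LinearMap.ker_eq_bot.2 hθ)
    have hQA : Q * A = C * Q := by
      ext i j
      have h1 : (Q * A) i j = Matrix.vecMul (θ (b i)) A j := rfl
      rw [h1, ← hθX, hC, map_sum, Finset.sum_apply]
      simp only [map_smul]
      rfl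
    obtain ⟨U, hU⟩ := hQ
    refine ⟨U⁻¹, ?_⟩
    rw [inv_inv, hU, hQA, ← hU, mul_assoc, Units.mul_inv, mul_one]

end Conjugacy

section RationalCanonicalForm

variable {K : Type*} [Field K] {n : ℕ}

/-- The module `⨁ K[X] / (f ^ (Λ f)_j)` over all monic irreducible `f` and all `j`. -/
abbrev canonicalModule (Λ : MonicIrred K → IntPartition) : Type _ :=
  ⨁ b : MonicIrred K × ℕ, (K[X] ⧸ Ideal.span {b.1.1 ^ (Λ b.1).parts b.2})

open Classical in
theorem isRationalCanonicalData_iff (A : Matrix (Fin n) (Fin n) K)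
    (Λ : MonicIrred K → IntPartition) :
    IsRationalCanonicalData A Λ ↔ Nonempty (rowModule A ≃ₗ[K[X]] canonicalModule Λ) := by
  have hg : ∀ b : MonicIrred K × ℕ, (b.1.1 ^ (Λ b.1).parts b.2).Monic :=
    fun b => b.1.2.1.pow _
  constructor
  · rintro ⟨P, e, h⟩
    exact (conj_iff_nonempty_equiv (D := canonicalModule Λ) ((sumQuotientBasis
      (fun b : MonicIrred K × ℕ => b.1.1 ^ (Λ b.1).parts b.2) hg).reindex e) A _
      (X_smul_sumQuotientBasis_reindex _ hg e)).1 ⟨P, h⟩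
  · rintro ⟨Φ⟩
    let b' : Module.Basis (Σ b : MonicIrred K × ℕ, Fin (b.1.1 ^ (Λ b.1).parts b.2).natDegree) K
        (Fin n → K) := (sumQuotientBasis _ hg).map
      ((Φ.symm.restrictScalars K) ≪≫ₗ (Module.AEval'.of A.vecMulLinear).symm)
    let e := b'.indexEquiv (Pi.basisFun K (Fin n))
    obtain ⟨P, h⟩ :=
      (conj_iff_nonempty_equiv (D := canonicalModule Λ) ((sumQuotientBasis
        (fun b : MonicIrred K × ℕ => b.1.1 ^ (Λ b.1).parts b.2) hg).reindex e) A _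
        (X_smul_sumQuotientBasis_reindex _ hg e)).2 ⟨Φ⟩
    exact ⟨P, e, h⟩

end RationalCanonicalForm

section DirectSumComap

variable {R ι κ : Type*} [CommRing R] {M : ι → Type*} [∀ i, AddCommGroup (M i)]
  [∀ i, Module R (M i)]

/-- Restriction of the elements of a direct sum along an injective map of the index types. -/
noncomputable def directSumComap (s : κ → ι) (hs : Function.Injective s) :
    (⨁ i, M i) →ₗ[R] ⨁ k, M (s k) where
  toFun x := DFinsupp.comapDomain s hs x
  map_add' x y := DFinsupp.comapDomain_add s hs x y
  map_smul' r x := DFinsupp.comapDomain_smul s hs r x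

theorem directSumComap_apply (s : κ → ι) (hs : Function.Injective s) (x : ⨁ i, M i) (k : κ) :
    directSumComap (R := R) s hs x k = x (s k) :=
  DFinsupp.comapDomain_apply s hs x k

theorem directSumComap_surjective (s : κ → ι) (hs : Function.Injective s) :
    Function.Surjective (directSumComap (R := R) (M := M) s hs) := by
  classical
  intro y
  induction y using DirectSum.induction_on with
  | zero => exact ⟨0, map_zero _⟩
  | of k m => exact ⟨DirectSum.of M (s k) m, DFinsupp.comapDomain_single s hs k m⟩
  | add x y hx hy =>
    obtain ⟨x', rfl⟩ := hx
    obtain ⟨y', rfl⟩ := hy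
    exact ⟨x' + y', map_add _ _ _⟩

theorem directSumComap_bijective (s : κ → ι) (hs : Function.Injective s)
    (h : ∀ i, i ∉ Set.range s → Subsingleton (M i)) :
    Function.Bijective (directSumComap (R := R) (M := M) s hs) := by
  refine ⟨fun x y hxy => DFinsupp.ext fun i => ?_, directSumComap_surjective s hs⟩
  by_cases hi : i ∈ Set.range s
  · obtain ⟨k, rfl⟩ := hi
    have := congrArg (fun z : ⨁ k, M (s k) => z k) hxy
    simpa only [directSumComap_apply] using this
  · exact (h i hi).elim _ _

end DirectSumComap

section Existence

variable {K : Type*} [Field K] {n : ℕ}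

theorem exists_antitone_equiv {ι : Type*} [Finite ι] (a : ι → ℕ) :
    ∃ e : Fin (Nat.card ι) ≃ ι, Antitone (a ∘ e) := by
  let g := (Finite.equivFin ι).symm
  let σ := Tuple.sort fun i => OrderDual.toDual (a (g i))
  refine ⟨σ.trans g, fun i j hij => ?_⟩
  exact Tuple.monotone_sort (fun i => OrderDual.toDual (a (g i))) hij

/-- The partition whose parts are the values of an antitone function on `Fin m`. -/
noncomputable def IntPartition.ofAntitone {m : ℕ} (a : Fin m → ℕ) (ha : Antitone a) :
    IntPartition where
  parts := Finsupp.onFinset (Finset.range m) (fun j => if h : j < m then a ⟨j, h⟩ else 0) (by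
    intro j hj
    by_contra h
    exact hj (dif_neg fun h' => h (Finset.mem_range.2 h')))
  antitone_parts := by
    intro i j hij
    simp only [Finsupp.onFinset_apply]
    split_ifs with h1 h2
    · exact ha (Fin.mk_le_mk.2 hij)
    · omega
    · exact Nat.zero_le _
    · exact le_rfl

theorem IntPartition.ofAntitone_apply {m : ℕ} (a : Fin m → ℕ) (ha : Antitone a) (j : Fin m) :
    (IntPartition.ofAntitone a ha).parts j = a j := by
  simp [IntPartition.ofAntitone]

theorem IntPartition.ofAntitone_eq_zero {m : ℕ} (a : Fin m → ℕ) (ha : Antitone a) {j : ℕ}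
    (hj : m ≤ j) : (IntPartition.ofAntitone a ha).parts j = 0 := by
  simp [IntPartition.ofAntitone, not_lt.2 hj]

theorem exists_canonicalModule_equiv {ι : Type*} [Finite ι] (F : ι → MonicIrred K) (a : ι → ℕ) :
    ∃ Λ : MonicIrred K → IntPartition,
      Nonempty ((⨁ i, K[X] ⧸ Ideal.span {(F i).1 ^ a i}) ≃ₗ[K[X]] canonicalModule Λ) := by
  choose e he using fun f : MonicIrred K =>
    exists_antitone_equiv fun i : {i // F i = f} => a i
  let Λ : MonicIrred K → IntPartition := fun f => IntPartition.ofAntitone _ (he f)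
  let s : ι → MonicIrred K × ℕ := fun i => (F i, (e (F i)).symm ⟨i, rfl⟩)
  have hs_e : ∀ f (j : Fin (Nat.card {i // F i = f})), s (e f j) = (f, (j : ℕ)) := by
    intro f j
    obtain ⟨⟨i, rfl⟩, hi⟩ : ∃ i, e f j = i := ⟨_, rfl⟩
    rw [hi]
    simp only [s]
    rw [← hi, Equiv.symm_apply_apply]
  have hs : Function.Injective s := by
    intro i i' h
    have h1 : F i = F i' := congrArg Prod.fst h
    obtain ⟨j, hj⟩ := (e (F i)).surjective ⟨i, rfl⟩
    obtain ⟨j', hj'⟩ := (e (F i)).surjective ⟨i', h1.symm⟩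
    have h2 := hs_e (F i) j
    have h3 := hs_e (F i) j'
    rw [hj] at h2
    rw [hj'] at h3
    have h4 : (F i, (j : ℕ)) = (F i, (j' : ℕ)) := h2.symm.trans (h.trans h3)
    have h5 : j = j' := Fin.ext (congrArg Prod.snd h4)
    rw [h5, hj'] at hj
    exact (congrArg Subtype.val hj).symm
  have hpart : ∀ i, (Λ (s i).1).parts (s i).2 = a i := by
    intro i
    change (IntPartition.ofAntitone _ (he (F i))).parts ((e (F i)).symm ⟨i, rfl⟩) = a i
    rw [IntPartition.ofAntitone_apply]
    simp
  have hsub : ∀ b : MonicIrred K × ℕ, b ∉ Set.range s →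
      Subsingleton (K[X] ⧸ Ideal.span {b.1.1 ^ (Λ b.1).parts b.2}) := by
    rintro ⟨f, j⟩ hb
    have hj : Nat.card {i // F i = f} ≤ j := by
      by_contra! h
      exact hb ⟨_, hs_e f ⟨j, h⟩⟩
    have h0 : (Λ f).parts j = 0 := IntPartition.ofAntitone_eq_zero _ (he f) hj
    simp only [h0, pow_zero, Ideal.span_singleton_one]
    exact Ideal.Quotient.subsingleton_iff.2 rfl
  refine ⟨Λ, ⟨?_⟩⟩
  have hspan : ∀ i, Ideal.span {(s i).1.1 ^ (Λ (s i).1).parts (s i).2}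
      = Ideal.span {(F i).1 ^ a i} := fun i => by rw [hpart]
  exact ((LinearEquiv.ofBijective (directSumComap (R := K[X])
    (M := fun b : MonicIrred K × ℕ => K[X] ⧸ Ideal.span {b.1.1 ^ (Λ b.1).parts b.2}) s hs)
    (directSumComap_bijective s hs hsub)) ≪≫ₗ
    DFinsupp.mapRange.linearEquiv fun i => Submodule.quotEquivOfEq _ _ (hspan i)).symm

/-- The existence of the rational canonical form. -/
theorem exists_isRationalCanonicalData (A : Matrix (Fin n) (Fin n) K) :
    ∃ Λ : MonicIrred K → IntPartition, IsRationalCanonicalData A Λ := by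
  classical
  have htors : Module.IsTorsion K[X] (rowModule A) :=
    Module.AEval.isTorsion_of_finiteDimensional K (Fin n → K) A.vecMulLinear
  obtain ⟨ι, _, q, hq, a, ⟨Φ⟩⟩ := Module.equiv_directSum_of_isTorsion htors
  let F : ι → MonicIrred K := fun i => ⟨normalize (q i), monic_normalize (hq i).ne_zero,
    (normalize_associated (q i)).irreducible_iff.2 (hq i)⟩
  obtain ⟨Λ, ⟨Ψ⟩⟩ := exists_canonicalModule_equiv F a
  have hspan : ∀ i, Ideal.span {q i ^ a i} = Ideal.span {(F i).1 ^ a i} := fun i =>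
    Ideal.span_singleton_eq_span_singleton.2 ((normalize_associated (q i)).symm.pow_pow)
  exact ⟨Λ, (isRationalCanonicalData_iff A Λ).2 ⟨Φ ≪≫ₗ
    (DFinsupp.mapRange.linearEquiv fun i => Submodule.quotEquivOfEq _ _ (hspan i)) ≪≫ₗ Ψ⟩⟩

end Existence

section Uniqueness

theorem IntPartition.lt_parts_iff (l : IntPartition) {N : ℕ} (hN : ∀ j, N ≤ j → l.parts j = 0)
    (k j : ℕ) :
    k < l.parts j ↔ j < ((Finset.range N).filter fun i => k < l.parts i).card := by
  constructor
  · intro h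
    have hsub : Finset.range (j + 1) ⊆ (Finset.range N).filter fun i => k < l.parts i := by
      intro i hi
      have hij : i ≤ j := Nat.lt_succ_iff.1 (Finset.mem_range.1 hi)
      have hk : k < l.parts i := h.trans_le (l.antitone_parts hij)
      refine Finset.mem_filter.2 ⟨Finset.mem_range.2 ?_, hk⟩
      by_contra! hNi
      rw [hN i hNi] at hk
      omega
    simpa using Finset.card_le_card hsub
  · intro h
    by_contra! hk
    have hsub : ((Finset.range N).filter fun i => k < l.parts i) ⊆ Finset.range j := by
      intro i hi
      rw [Finset.mem_range]
      by_contra! hji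
      have := (Finset.mem_filter.1 hi).2
      have h2 := l.antitone_parts hji
      omega
    have := Finset.card_le_card hsub
    rw [Finset.card_range] at this
    omega

/-- A partition is determined by the sizes of its truncations. -/
theorem IntPartition.ext_of_sum_sub {l l' : IntPartition} {N : ℕ}
    (hN : ∀ j, N ≤ j → l.parts j = 0) (hN' : ∀ j, N ≤ j → l'.parts j = 0)
    (h : ∀ k, ∑ j ∈ Finset.range N, (l.parts j - k) = ∑ j ∈ Finset.range N, (l'.parts j - k)) :
    l = l' := by
  have hstep : ∀ (l : IntPartition) k, ∑ j ∈ Finset.range N, (l.parts j - k)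
      = ∑ j ∈ Finset.range N, (l.parts j - (k + 1))
        + ((Finset.range N).filter fun i => k < l.parts i).card := by
    intro l k
    rw [Finset.card_filter, ← Finset.sum_add_distrib]
    refine Finset.sum_congr rfl fun j _ => ?_
    split_ifs <;> omega
  have hcard : ∀ k, ((Finset.range N).filter fun i => k < l.parts i).card
      = ((Finset.range N).filter fun i => k < l'.parts i).card := by
    intro k
    have h1 := hstep l k
    have h2 := hstep l' k
    have h3 := h k
    have h4 := h (k + 1)
    omega
  ext j
  refine eq_of_forall_lt_iff fun k => ?_
  rw [l.lt_parts_iff hN, l'.lt_parts_iff hN', hcard]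

/-- Subtract `k` from all the parts. -/
noncomputable def IntPartition.sub (l : IntPartition) (k : ℕ) : IntPartition where
  parts := l.parts.mapRange (· - k) (Nat.zero_sub k)
  antitone_parts i j hij := by
    simp only [Finsupp.mapRange_apply]
    exact Nat.sub_le_sub_right (l.antitone_parts hij) k

variable {K : Type*} [Field K]

theorem finite_sigma_of_support {m : ℕ → ℕ} {N : ℕ} (hN : ∀ j, N ≤ j → m j = 0) :
    Finite (Σ j, Fin (m j)) ∧ Nat.card (Σ j, Fin (m j)) = ∑ j ∈ Finset.range N, m j := by
  let s : Finset (Σ j, Fin (m j)) := (Finset.range N).sigma fun _ => Finset.univ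
  have hs : ∀ x, x ∈ s := by
    rintro ⟨j, i⟩
    simp only [s, Finset.mem_sigma, Finset.mem_range, Finset.mem_univ, and_true]
    by_contra! h
    have := hN j h
    have := i.2
    omega
  let : Fintype (Σ j, Fin (m j)) := ⟨s, hs⟩
  refine ⟨inferInstance, ?_⟩
  rw [Nat.card_eq_fintype_card, Fintype.card, show (Finset.univ : Finset (Σ j, Fin (m j))) = s from
    rfl, Finset.card_sigma]
  simp

theorem finrank_partitionModule (f : MonicIrred K) (l : IntPartition) {N : ℕ}
    (hN : ∀ j, N ≤ j → l.parts j = 0) :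
    FiniteDimensional K (partitionModule f.1 l) ∧
    Module.finrank K (partitionModule f.1 l)
      = (∑ j ∈ Finset.range N, l.parts j) * f.1.natDegree := by
  have h := finite_sigma_of_support (m := fun j => (f.1 ^ l.parts j).natDegree) (N := N)
    fun j hj => by simp [hN j hj]
  have := h.1
  let b := sumQuotientBasis (fun j => f.1 ^ l.parts j) fun j => f.2.1.pow _
  refine ⟨Module.Finite.of_basis b, ?_⟩
  rw [Module.finrank_eq_nat_card_basis b, h.2, Finset.sum_mul]
  exact Finset.sum_congr rfl fun j _ => natDegree_pow _ _

theorem IntPartition.exists_bound (l : IntPartition) : ∃ N, ∀ j, N ≤ j → l.parts j = 0 := by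
  obtain ⟨N, hN⟩ := l.parts.support.exists_nat_subset_range
  refine ⟨N, fun j hj => ?_⟩
  by_contra h
  have := Finset.mem_range.1 (hN (Finsupp.mem_support_iff.2 h))
  omega

theorem pow_smul_partitionModule (f : K[X]) (l : IntPartition) (x : partitionModule f l) :
    f ^ l.parts 0 • x = 0 := by
  refine DFinsupp.ext fun j => ?_
  obtain ⟨r, hr⟩ := Ideal.Quotient.mk_surjective (x j)
  change f ^ l.parts 0 • x j = 0
  rw [← hr]
  change Ideal.Quotient.mk _ (f ^ l.parts 0 * r) = 0
  rw [Ideal.Quotient.eq_zero_iff_mem]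
  exact Ideal.mul_mem_right _ _ (Ideal.mem_span_singleton.2
    (pow_dvd_pow f (l.antitone_parts (Nat.zero_le j))))

/-- Multiplication by `f ^ k` identifies the module of the truncated partition with the image of
`f ^ k`. -/
theorem exists_partitionModule_sub_embedding (f : K[X]) (hf : f ≠ 0) (l : IntPartition) (k : ℕ) :
    ∃ φ : partitionModule f (l.sub k) →ₗ[K[X]] partitionModule f l, Function.Injective φ ∧
      LinearMap.range φ = LinearMap.range (LinearMap.lsmul K[X] (partitionModule f l) (f ^ k)) := by
  have hle : ∀ j, (Ideal.span {f ^ (l.sub k).parts j} : Submodule K[X] K[X]) ≤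
      Submodule.comap (LinearMap.lsmul K[X] K[X] (f ^ k)) (Ideal.span {f ^ l.parts j}) := by
    intro j
    rw [Ideal.span, Submodule.span_le, Set.singleton_subset_iff]
    change f ^ k * f ^ (l.parts j - k) ∈ Ideal.span {f ^ l.parts j}
    rw [← pow_add, Ideal.mem_span_singleton]
    exact pow_dvd_pow f (by omega)
  have hle' : ∀ j, (Ideal.span {f ^ l.parts j} : Submodule K[X] K[X]) ≤
      Ideal.span {f ^ (l.sub k).parts j} := fun j =>
    Ideal.span_singleton_le_span_singleton.2 (pow_dvd_pow f (Nat.sub_le _ _))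
  let φ : ∀ j, (K[X] ⧸ Ideal.span {f ^ (l.sub k).parts j}) →ₗ[K[X]]
      (K[X] ⧸ Ideal.span {f ^ l.parts j}) := fun j => Submodule.mapQ _ _ _ (hle j)
  have hφ : ∀ j r, φ j (Ideal.Quotient.mk _ r) = Ideal.Quotient.mk _ (f ^ k * r) := fun _ _ => rfl
  let ψ : ∀ j, (K[X] ⧸ Ideal.span {f ^ l.parts j}) →ₗ[K[X]]
      (K[X] ⧸ Ideal.span {f ^ (l.sub k).parts j}) := fun j => Submodule.factor (hle' j)
  have hinj : ∀ j, Function.Injective (φ j) := by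
    intro j
    rw [injective_iff_map_eq_zero]
    intro x hx
    obtain ⟨r, rfl⟩ := Ideal.Quotient.mk_surjective x
    rw [hφ, Ideal.Quotient.eq_zero_iff_mem, Ideal.mem_span_singleton] at hx
    rw [Ideal.Quotient.eq_zero_iff_mem, Ideal.mem_span_singleton]
    change f ^ (l.parts j - k) ∣ r
    by_cases h : k ≤ l.parts j
    · rw [← mul_dvd_mul_iff_left (pow_ne_zero k hf), ← pow_add, Nat.add_sub_cancel' h]
      exact hx
    · rw [Nat.sub_eq_zero_of_le (by omega), pow_zero]
      exact one_dvd r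
  have hψ : ∀ j x, φ j (ψ j x) = f ^ k • x := by
    intro j x
    obtain ⟨r, rfl⟩ := Ideal.Quotient.mk_surjective x
    rfl
  let Φ : partitionModule f (l.sub k) →ₗ[K[X]] partitionModule f l := DFinsupp.mapRange.linearMap φ
  let Ψ : partitionModule f l →ₗ[K[X]] partitionModule f (l.sub k) := DFinsupp.mapRange.linearMap ψ
  have hΨ : Function.Surjective Ψ :=
    (DFinsupp.mapRange_surjective _ fun j => map_zero (ψ j)).2 fun j =>
      Submodule.factor_surjective (hle' j)
  have hΦΨ : Φ ∘ₗ Ψ = LinearMap.lsmul K[X] (partitionModule f l) (f ^ k) :=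
    LinearMap.ext fun x => DFinsupp.ext fun j => hψ j (x j)
  refine ⟨Φ, fun x y hxy => DFinsupp.ext fun j => hinj j ?_, ?_⟩
  · exact congrArg (fun z : partitionModule f l => z j) hxy
  · rw [← hΦΨ, LinearMap.range_comp_of_range_eq_top _ (LinearMap.range_eq_top.2 hΨ)]

theorem eq_of_partitionModule_equiv (f : MonicIrred K) {l l' : IntPartition}
    (α : partitionModule f.1 l ≃ₗ[K[X]] partitionModule f.1 l') : l = l' := by
  obtain ⟨N₁, hN₁⟩ := l.exists_bound
  obtain ⟨N₂, hN₂⟩ := l'.exists_bound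
  have h1 : ∀ j, max N₁ N₂ ≤ j → l.parts j = 0 := fun j hj => hN₁ j ((le_max_left _ _).trans hj)
  have h2 : ∀ j, max N₁ N₂ ≤ j → l'.parts j = 0 := fun j hj => hN₂ j ((le_max_right _ _).trans hj)
  refine IntPartition.ext_of_sum_sub h1 h2 fun k => ?_
  obtain ⟨φ, hφ, hφr⟩ := exists_partitionModule_sub_embedding f.1 f.2.2.ne_zero l k
  obtain ⟨φ', hφ', hφr'⟩ := exists_partitionModule_sub_embedding f.1 f.2.2.ne_zero l' k
  have hmap : (LinearMap.range φ).map α.toLinearMap = LinearMap.range φ' := by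
    rw [hφr, hφr']
    ext y
    constructor
    · rintro ⟨_, ⟨x, rfl⟩, rfl⟩
      exact ⟨α x, (map_smul α (f.1 ^ k) x).symm⟩
    · rintro ⟨x, rfl⟩
      refine ⟨f.1 ^ k • α.symm x, ⟨α.symm x, rfl⟩, ?_⟩
      change α (f.1 ^ k • α.symm x) = f.1 ^ k • x
      rw [map_smul, α.apply_symm_apply]
  let β : partitionModule f.1 (l.sub k) ≃ₗ[K[X]] partitionModule f.1 (l'.sub k) :=
    LinearEquiv.ofInjective φ hφ ≪≫ₗ α.submoduleMap (LinearMap.range φ) ≪≫ₗ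
      LinearEquiv.ofEq _ _ hmap ≪≫ₗ (LinearEquiv.ofInjective φ' hφ').symm
  have hfr := (β.restrictScalars K).finrank_eq
  have hsub : ∀ l : IntPartition, ∀ j, (l.sub k).parts j = l.parts j - k := fun _ _ => rfl
  rw [(finrank_partitionModule f (l.sub k) fun j hj => by rw [hsub, h1 j hj, Nat.zero_sub]).2,
    (finrank_partitionModule f (l'.sub k) fun j hj => by rw [hsub, h2 j hj, Nat.zero_sub]).2] at hfr
  exact Nat.eq_of_mul_eq_mul_right f.2.2.natDegree_pos hfr

end Uniqueness

section GoodProjection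

variable {K : Type*} [Field K]

/-- The projection of the canonical module to its `f`-primary part is a good surjection. -/
theorem nonempty_goodSurj_canonicalModule (Λ : MonicIrred K → IntPartition) (f : MonicIrred K) :
    Nonempty (GoodSurj f.1 (canonicalModule Λ) (partitionModule f.1 (Λ f))) := by
  classical
  let s : ℕ → MonicIrred K × ℕ := fun j => (f, j)
  have hs : Function.Injective s := Prod.mk_right_injective f
  let φ : canonicalModule Λ →ₗ[K[X]] partitionModule f.1 (Λ f) := directSumComap (R := K[X])
    (M := fun b : MonicIrred K × ℕ => K[X] ⧸ Ideal.span {b.1.1 ^ (Λ b.1).parts b.2}) s hs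
  refine ⟨φ, directSumComap_surjective s hs, fun x => ?_⟩
  have hu : ∀ b : MonicIrred K × ℕ, ∃ u : K[X], b.1 ≠ f →
      ∀ y : K[X] ⧸ Ideal.span {b.1.1 ^ (Λ b.1).parts b.2}, f.1 • u • y = y := by
    intro b
    by_cases hb : b.1 = f
    · exact ⟨0, fun h => (h hb).elim⟩
    · have hcop : IsCoprime f.1 (b.1.1 ^ (Λ b.1).parts b.2) := by
        refine IsCoprime.pow_right (f.2.2.coprime_iff_not_dvd.2 fun hdvd => hb ?_)
        exact Subtype.ext (eq_of_monic_of_associated b.1.2.1 f.2.1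
          (f.2.2.associated_of_dvd b.1.2.2 hdvd).symm)
      obtain ⟨u, v, huv⟩ := hcop
      refine ⟨u, fun _ y => ?_⟩
      obtain ⟨r, rfl⟩ := Ideal.Quotient.mk_surjective y
      change Ideal.Quotient.mk _ (f.1 * (u * r)) = Ideal.Quotient.mk _ r
      rw [Ideal.Quotient.mk_eq_mk_iff_sub_mem, Ideal.mem_span_singleton]
      refine ⟨-v * r, ?_⟩
      linear_combination r * huv
  choose u hu using hu
  let y : canonicalModule Λ := DFinsupp.mapRange.linearMap
    (fun b : MonicIrred K × ℕ => LinearMap.lsmul K[X]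
      (K[X] ⧸ Ideal.span {b.1.1 ^ (Λ b.1).parts b.2}) (u b)) x.1
  have hy : ∀ b, y b = u b • x.1 b := fun _ => rfl
  have hx : ∀ j, x.1 (f, j) = 0 := fun j =>
    congrArg (fun z : partitionModule f.1 (Λ f) => z j) (LinearMap.mem_ker.1 x.2)
  refine ⟨⟨y, LinearMap.mem_ker.2 (DFinsupp.ext fun j => ?_)⟩, Subtype.ext (DFinsupp.ext fun b => ?_)⟩
  · change y (f, j) = 0
    rw [hy, hx, smul_zero]
  · change f.1 • y b = x.1 b
    rw [hy]
    by_cases hb : b.1 = f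
    · obtain ⟨b₁, b₂⟩ := b
      obtain rfl : b₁ = f := hb
      rw [hx, smul_zero, smul_zero]
    · exact hu b hb _

theorem nonempty_goodSurj_of_equiv {R M M' G : Type*} [CommRing R] [AddCommGroup M] [Module R M]
    [AddCommGroup M'] [Module R M'] [AddCommGroup G] [Module R G] {f : R} (e : M' ≃ₗ[R] M)
    (φ : GoodSurj f M G) : Nonempty (GoodSurj f M' G) := by
  refine ⟨φ.1 ∘ₗ e.toLinearMap, φ.2.1.comp e.surjective, fun x => ?_⟩
  obtain ⟨y, hy⟩ := φ.2.2 ⟨e x, x.2⟩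
  refine ⟨⟨e.symm y, ?_⟩, Subtype.ext (e.injective ?_)⟩
  · rw [LinearMap.mem_ker, LinearMap.comp_apply, LinearEquiv.coe_coe, e.apply_symm_apply]
    exact y.2
  · change e (f • e.symm y) = e x
    rw [map_smul, e.apply_symm_apply]
    exact congrArg Subtype.val hy

open Classical in
theorem card_goodSurj_rowModule {n : ℕ} (A : Matrix (Fin n) (Fin n) K) (f : MonicIrred K)
    (l : IntPartition) :
    Nat.card (GoodSurj f.1 (rowModule A) (partitionModule f.1 l))
      = if rcfPartition A f = l then
          Nat.card (partitionModule f.1 l ≃ₗ[K[X]] partitionModule f.1 l) else 0 := by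
  have hex := exists_isRationalCanonicalData A
  obtain ⟨e⟩ := (isRationalCanonicalData_iff A _).1 hex.choose_spec
  have hrcf : rcfPartition A f = hex.choose f := by rw [rcfPartition, dif_pos hex]
  obtain ⟨φ₀⟩ := nonempty_goodSurj_canonicalModule hex.choose f
  obtain ⟨φ⟩ := nonempty_goodSurj_of_equiv e φ₀
  rw [← hrcf] at φ
  have hpow : ∀ (l : IntPartition) N, l.parts 0 ≤ N → ∀ g : partitionModule f.1 l,
      f.1 ^ N • g = 0 := by
    intro l N hN g
    rw [← Nat.sub_add_cancel hN, pow_add, mul_smul, pow_smul_partitionModule, smul_zero]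
  split_ifs with h
  · subst h
    exact φ.card_eq (hpow _ _ le_rfl)
  · have : IsEmpty (GoodSurj f.1 (rowModule A) (partitionModule f.1 l)) := by
      refine ⟨fun φ' => h ?_⟩
      obtain ⟨α, -⟩ := φ.exists_equiv (N := max ((rcfPartition A f).parts 0) (l.parts 0))
        (hpow _ _ (le_max_left _ _)) (hpow _ _ (le_max_right _ _)) φ'
      exact eq_of_partitionModule_equiv f α
    simp

end GoodProjection

section ResidueFieldExists

theorem exists_residueField {K : Type} [Field K] [Finite K] (f : MonicIrred K) :
    ∃ (k : Type) (_ : Field k) (_ : Algebra K[X] k), Finite k ∧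
      Function.Surjective (algebraMap K[X] k) ∧
      RingHom.ker (algebraMap K[X] k) = Ideal.span {f.1} ∧
      Nat.card k = Nat.card K ^ f.1.natDegree := by
  have : Fact (Irreducible f.1) := ⟨f.2.2⟩
  have hfin : Module.Finite K (AdjoinRoot f.1) := (AdjoinRoot.powerBasis' f.2.1).finite
  refine ⟨AdjoinRoot f.1, inferInstance, (AdjoinRoot.mk f.1).toAlgebra,
    Module.finite_of_finite K, AdjoinRoot.mk_surjective, Ideal.mk_ker, ?_⟩
  rw [Module.natCard_eq_pow_finrank (K := K), (AdjoinRoot.powerBasis' f.2.1).finrank,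
    AdjoinRoot.powerBasis'_dim]

theorem MonicIrred.isCoprime {K : Type*} [Field K] {f g : MonicIrred K} (h : f ≠ g) :
    IsCoprime f.1 g.1 :=
  f.2.2.coprime_iff_not_dvd.2 fun hdvd => h <| Subtype.ext <|
    eq_of_monic_of_associated f.2.1 g.2.1 (f.2.2.associated_of_dvd g.2.2 hdvd)

theorem finite_partitionModule {K : Type*} [Field K] [Finite K] (f : MonicIrred K)
    (l : IntPartition) : Finite (partitionModule f.1 l) := by
  obtain ⟨N, hN⟩ := l.exists_bound
  have := (finrank_partitionModule f l hN).1
  exact Module.finite_of_finite K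

end ResidueFieldExists

theorem tendsto_matrixExp_prod_card_goodSurj {p : ℕ} [Fact p.Prime] {ε : ℝ} (hε : 0 < ε)
    {w : ∀ n, Fin n → Fin n → ZMod p → ℝ} (hw : ∀ n i j, IsBalancedWeight ε (w n i j))
    {ι : Type*} [Fintype ι] (f : ι → MonicIrred (ZMod p)) (hf : Function.Injective f)
    (l : ι → IntPartition) :
    Tendsto (fun n => matrixExp (w n) fun M => ∏ i,
        (Nat.card (GoodSurj (f i).1 (rowModule M) (partitionModule (f i).1 (l i))) : ℝ)) atTop
      (𝓝 (∏ i, ∏' j : ℕ, (1 - ((p : ℝ) ^ ((j + 1) * (f i).1.natDegree))⁻¹))) := by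
  choose k hfield halg hfin hsurj hker hcard using fun i => exists_residueField (f i)
  let : ∀ i, Algebra (ZMod p) (k i) := fun i =>
    ((algebraMap (ZMod p)[X] (k i)).comp C).toAlgebra
  have : ∀ i, IsScalarTower (ZMod p) (ZMod p)[X] (k i) := fun i =>
    IsScalarTower.of_algebraMap_eq' rfl
  have : ∀ i, Finite (partitionModule (f i).1 (l i)) := fun i => finite_partitionModule _ _
  have hq : ∀ i, (1 : ℝ) < Nat.card (k i) := fun i => by exact_mod_cast Finite.one_lt_card
  have hpow : ∀ i, (∏' j : ℕ, (1 - ((p : ℝ) ^ ((j + 1) * (f i).1.natDegree))⁻¹))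
      = ∏' j : ℕ, (1 - ((Nat.card (k i) : ℝ) ^ (j + 1))⁻¹) := by
    intro i
    rw [hcard, Nat.card_zmod]
    push_cast
    simp only [← pow_mul, mul_comm]
  simp only [hpow]
  refine tendsto_matrixExp_prod_of_bonferroni (fun n i j => (hw n i j).nonneg)
    (fun i n M => (Nat.card (GoodSurj (f i).1 (rowModule M) (partitionModule (f i).1 (l i))) : ℝ))
    (fun i e n M => (Nat.card (SurjPair (ZMod p)[X] (rowModule M)
      (partitionModule (f i).1 (l i)) (Fin e → k i)) : ℝ))
    (fun _ _ _ => Nat.cast_nonneg _) (fun _ _ _ _ => Nat.cast_nonneg _)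
    (fun i => eulerCoeff (Nat.card (k i))) _ (fun i => hasSum_eulerCoeff (hq i))
    (fun i m n M => abs_card_goodSurj_sub_le (hsurj i) (hker i) m) fun e => ?_
  refine tendsto_matrixExp_prod_card_surjPair hε hw (fun i => partitionModule (f i).1 (l i))
    (fun i => Fin (e i) → k i) (fun i => (f i).1 ^ (l i).parts 0) (fun i => (f i).1) ?_
    (fun i => pow_smul_partitionModule _ _) fun i v => ?_
  · intro i j hij
    have h := MonicIrred.isCoprime (hf.ne hij)
    simp only [← pow_succ']
    exact h.pow
  · have h0 : algebraMap (ZMod p)[X] (k i) (f i).1 = 0 := by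
      rw [← RingHom.mem_ker, hker]
      exact Ideal.mem_span_singleton_self _
    funext s
    rw [Pi.smul_apply, Algebra.smul_def, h0, zero_mul, Pi.zero_apply]

theorem theorem1p1 (p : ℕ) [Fact p.Prime] (ε : ℝ) (hε : ε ∈ Set.Ioc (0 : ℝ) (1 - 1 / (p : ℝ)))
    {Ω : ℕ → Type*} [∀ n, MeasurableSpace (Ω n)] (P : ∀ n, Measure (Ω n))
    [∀ n, IsProbabilityMeasure (P n)]
    (A : ∀ n, Ω n → Matrix (Fin n) (Fin n) (ZMod p))
    (hmeas : ∀ n (i j : Fin n), Measurable fun ω => A n ω i j)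
    (hindep : ∀ n, iIndepFun (fun (ij : Fin n × Fin n) (ω : Ω n) => A n ω ij.1 ij.2) (P n))
    (hbal : ∀ n (i j : Fin n), IsBalanced (P n) ε fun ω => A n ω i j)
    {r : ℕ} (f : Fin r → MonicIrred (ZMod p)) (hf : Function.Injective f)
    (l : Fin r → IntPartition) :
    Tendsto (fun n => (P n).real {ω | ∀ i, rcfPartition (A n ω) (f i) = l i}) atTop
      (𝓝 (∏ i, cohenLenstraMass p (f i) (l i))) := by
  classical
  let w : ∀ n, Fin n → Fin n → ZMod p → ℝ := fun n i j x => (P n).real {ω | A n ω i j = x}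
  have hw : ∀ n i j, IsBalancedWeight ε (w n i j) := fun n i j =>
    isBalancedWeight_of_isBalanced (hmeas n i j) (hbal n i j)
  have hfin : ∀ i, Finite (partitionModule (f i).1 (l i)) := fun i => finite_partitionModule _ _
  let c : Fin r → ℝ := fun i =>
    (Nat.card (partitionModule (f i).1 (l i) ≃ₗ[(ZMod p)[X]] partitionModule (f i).1 (l i)) : ℝ)
  have hc : ∀ i, c i ≠ 0 := fun i => by
    have : Finite (partitionModule (f i).1 (l i) ≃ₗ[(ZMod p)[X]] partitionModule (f i).1 (l i)) :=
      Finite.of_injective (fun F => (F : partitionModule (f i).1 (l i) → _)) DFunLike.coe_injective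
    exact Nat.cast_ne_zero.2 Nat.card_pos.ne'
  have hprob : ∀ n, (P n).real {ω | ∀ i, rcfPartition (A n ω) (f i) = l i}
      = (∏ i, c i)⁻¹ * matrixExp (w n) fun M => ∏ i,
        (Nat.card (GoodSurj (f i).1 (rowModule M) (partitionModule (f i).1 (l i))) : ℝ) := by
    intro n
    rw [measureReal_eq_matrixExp (P n) (A n) (hmeas n) (hindep n)
      (fun M => ∀ i, rcfPartition M (f i) = l i), ← matrixExp_const_mul]
    congr 1
    funext M
    have h1 : ∀ i, (Nat.card (GoodSurj (f i).1 (rowModule M) (partitionModule (f i).1 (l i))) : ℝ)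
        = c i * if rcfPartition M (f i) = l i then 1 else 0 := fun i => by
      rw [card_goodSurj_rowModule]
      split_ifs <;> simp [c]
    simp only [h1]
    rw [Finset.prod_mul_distrib, ← mul_assoc,
      inv_mul_cancel₀ (Finset.prod_ne_zero_iff.2 fun i _ => hc i), one_mul, Finset.prod_boole]
    simp
  have hlim := (tendsto_matrixExp_prod_card_goodSurj hε.1 hw f hf l).const_mul (∏ i, c i)⁻¹
  simp only [← hprob] at hlim
  rw [← Finset.prod_inv_distrib, ← Finset.prod_mul_distrib] at hlim
  simpa only [cohenLenstraMass, one_div] using hlim
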